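/- Let $\mathbb{I}=[0,1)$ with Lebesgue measure $\mu$, $\boldsymbol\mu=\mu\otimes\mu$, $\mathbb N=\{0,1,2,\dots\}$. For $x\in\mathbb I$ let $x=\sum_{k\ge0}x_k2^{-k-1}$ be its dyadic expansion (the terminating one for dyadic rationals), $x\dotplus y=\sum_{k\ge 0}|x_k-y_k|2^{-k-1}$ the dyadic sum, and $I_n(x)$ the dyadic interval $[p2^{-n},(p+1)2^{-n})$ containing $x$. For $n\in\mathbb N$ write $n=\sum_k\varepsilon_k(n)2^k$ with $\varepsilon_k(n)\in\{0,1\}$ and, for $n\ge1$, let $|n|$ be the largest $k$ with $\varepsilon_k(n)=1$ (put $|0|=0$). Let $w_n(x)=\prod_{k}(-1)^{\varepsilon_k(n)x_k}$ be the Walsh–Paley functions, $D_k=\sum_{j<k}w_j$, and $S_kf=\sum_{j<k}\big(\int_{\mathbb I} f w_j\,d\mu\big)w_j$ for $f\in L_1(\mathbb I)$. All functions are real-valued. $H_1(\mathbb I)$ is the dyadic Hardy space of $f\in L_1(\mathbb I)$ with $\|f\|_{H_1}=\big\|\sup_{n}2^n\big|\int_{I_n(\cdot)}f\,d\mu\big|\big\|_1<\infty$,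 and $L\ln L(\mathbb I^2)$ is the set of $f\in L_1(\mathbb I^2)$ with $\int_{\mathbb I^2}|f|\ln^+|f|\,d\boldsymbol\mu<\infty$. A matrix of transformation is a matrix $\mathbb T=(t_{k,n})_{k,n\in\mathbb N}$ with $0\le t_{k+1,n}\le t_{k,n}$ for all $k,n$ and $\sum_{k=0}^nt_{k,n}=1$ for all $n$. Put $$\mathcal T_n^{\mathbb T}f=\sum_{k=0}^nt_{n-k,n}S_kf,\qquad V_n^{\mathbb T}=\sum_{k=1}^nt_{n-k,n}D_k,\qquad \tau_{s,n}=\sum_{l=0}^st_{l,n},\qquad \upsilon(n,\mathbb T)=\sum_{k=0}^{|n|}|\varepsilon_k(n)-\varepsilon_{k+1}(n)|\,\tau_{2^k,n},$$ and for two matrices of transformation $\mathbb T_0,\mathbb T_1$ and $f\in L_1(\mathbb I^2)$ put $$\big(\mathcal T^{\mathbb T_0}_{n}\otimes\mathcal T^{\mathbb T_1}_{m}\big)f(x^0,x^1)=\int_{\mathbb I^2}f(u^0,u^1)\,V^{\mathbb T_0}_{n}(x^0\dotplus u^0)\,V^{\mathbb T_1}_{m}(x^1\dotplus u^1)\,d\boldsymbol\mu(u^0,u^1).$$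 For $f\in L_1(\mathbb I^2)$ and $x=(x^0,x^1)\in\mathbb I^2$ let $\Delta(s)=|f(s)-f(x)|$ and $$W_{n^0,n^1}f(x)=\sum_{i=0}^{n^0}\sum_{j=0}^{n^1}2^{i+j}\int_{I_{n^0}(x^0\dotplus2^{-i-1})\times I_{n^1}(x^1\dotplus2^{-j-1})}\Delta\,d\boldsymbol\mu,$$ $$H^{(0)}_{n}f(x)=\sum_{i=0}^{n}2^i\int_{I_n(x^0\dotplus2^{-i-1})\times\mathbb I}\Delta\,d\boldsymbol\mu,\qquad H^{(1)}_{n}f(x)=\sum_{i=0}^{n}2^i\int_{\mathbb I\times I_n(x^1\dotplus2^{-i-1})}\Delta\,d\boldsymbol\mu .$$ The point $x$ is a two-dimensional Walsh–Lebesgue point of $f$ if $W_{n^0,n^1}f(x)\to0$ as $\min\{n^0,n^1\}\to\infty$, $\sup_nH^{(0)}_nf(x)<\infty$ and $\sup_nH^{(1)}_nf(x)<\infty$. **Theorem.** Let $\mathbb T_i=(t^i_{k,n})$, $i=0,1$, be matrices of transformation and $\{n^i_a:a\in\mathbb N\}$, $i=0,1$, strictly increasing sequences of natural numbers. Assume that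 for each $i\in\{0,1\}$ at least one of the following holds: (i) $\sup_a\|\mathcal T^{\mathbb T_i}_{n^i_a}\|_{H_1(\mathbb I)\to L_1(\mathbb I)}<\infty$; (ii) $\sup_a\|\mathcal T^{\mathbb T_i}_{n^i_a}\|_{L_\infty(\mathbb I)\to L_\infty(\mathbb I)}<\infty$; (iii) $\sup_a\upsilon(n^i_a,\mathbb T_i)<\infty$. Assume moreover that $t^i_{0,n^i_a}\to0$ as $a\to\infty$ for $i=0,1$. Then for every $f\in L\ln L(\mathbb I^2)$ and every two-dimensional Walsh–Lebesgue point $(x^0,x^1)$ of $f$, $$\big(\mathcal T^{\mathbb T_0}_{n^0_a}\otimes\mathcal T^{\mathbb T_1}_{n^1_b}\big)f(x^0,x^1)\to f(x^0,x^1)\qquad\text{as }\min\{n^0_a,n^1_b\}\to\infty .$$ -/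

import Mathlib

open MeasureTheory Filter Topology
open scoped ENNReal

noncomputable section

namespace WalshPaley

/-- The unit interval `𝕀 = [0, 1)`. -/
def unitI : Set ℝ := Set.Ico 0 1

/-- Lebesgue measure on `𝕀`. Functions on `𝕀` are functions on `ℝ`, considered on `𝕀` only. -/
def μI : Measure ℝ := volume.restrict unitI

/-- The binary coefficient `ε_k(n)` of the natural number `n`. -/
def binCoeff (n k : ℕ) : ℕ := n / 2 ^ k % 2

/-- The `k`-th dyadic digit of `x ∈ [0, 1)`, so that `x = ∑ k, x_k 2^{-(k+1)}`
(the terminating expansion is chosen for dyadic rationals). -/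
def digit (x : ℝ) (k : ℕ) : ℕ := ⌊(2 : ℝ) ^ (k + 1) * x⌋₊ % 2

/-- The dyadic sum `x ∔ y = ∑ k, |x_k - y_k| 2^{-(k+1)}`. -/
def dyadicAdd (x y : ℝ) : ℝ := ∑' k : ℕ, |(digit x k : ℝ) - (digit y k : ℝ)| / 2 ^ (k + 1)

/-- The dyadic interval `I_n(x)` of order `n` that contains `x`. -/
def dyadicInterval (n : ℕ) (x : ℝ) : Set ℝ :=
  Set.Ico ((⌊(2 : ℝ) ^ n * x⌋ : ℝ) / 2 ^ n) (((⌊(2 : ℝ) ^ n * x⌋ : ℝ) + 1) / 2 ^ n)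

/-- The Rademacher functions. -/
def rademacher (k : ℕ) (x : ℝ) : ℝ := (-1) ^ digit x k

/-- The Walsh functions in the Paley ordering. Here `Nat.log 2 n` is the order `|n|` of `n`. -/
def walsh (n : ℕ) (x : ℝ) : ℝ :=
  ∏ k ∈ Finset.range (Nat.log 2 n + 1), rademacher k x ^ binCoeff n k

/-- The Walsh-Fourier coefficients. -/
def walshCoeff (f : ℝ → ℝ) (j : ℕ) : ℝ := ∫ u, f u * walsh j u ∂μI

/-- The `k`-th partial sum of the Walsh-Fourier series (the sum of the first `k` terms). -/
def partialSum (k : ℕ) (f : ℝ → ℝ) (x : ℝ) : ℝ :=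
  ∑ j ∈ Finset.range k, walshCoeff f j * walsh j x

/-- The Walsh-Dirichlet kernels. -/
def dirichletKernel (k : ℕ) (x : ℝ) : ℝ := ∑ j ∈ Finset.range k, walsh j x

/-- A matrix of transformation `(t_{k,n})`, with `t k n = t_{k,n}`. -/
structure IsTransformationMatrix (t : ℕ → ℕ → ℝ) : Prop where
  nonneg : ∀ k n, 0 ≤ t k n
  mono : ∀ k n, t (k + 1) n ≤ t k n
  sum_eq_one : ∀ n, ∑ k ∈ Finset.range (n + 1), t k n = 1

/-- The one-dimensional means `𝒯_n f = ∑_{k=0}^n t_{n-k,n} S_k f`. -/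
def weightedMean (t : ℕ → ℕ → ℝ) (n : ℕ) (f : ℝ → ℝ) (x : ℝ) : ℝ :=
  ∑ k ∈ Finset.range (n + 1), t (n - k) n * partialSum k f x

/-- The kernels `V_n = ∑_{k=1}^n t_{n-k,n} D_k`. -/
def meanKernel (t : ℕ → ℕ → ℝ) (n : ℕ) (x : ℝ) : ℝ :=
  ∑ k ∈ Finset.Icc 1 n, t (n - k) n * dirichletKernel k x

/-- The tensor product means: the dyadic convolution of `f` with `V_{n⁰} ⊗ V_{n¹}`. -/
def tensorMean (t₀ t₁ : ℕ → ℕ → ℝ) (n₀ n₁ : ℕ) (f : ℝ × ℝ → ℝ) (x : ℝ × ℝ) : ℝ :=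
  ∫ u, f u * (meanKernel t₀ n₀ (dyadicAdd x.1 u.1) * meanKernel t₁ n₁ (dyadicAdd x.2 u.2))
    ∂(μI.prod μI)

/-- `τ_{s,n} = ∑_{l=0}^s t_{l,n}`. -/
def tau (t : ℕ → ℕ → ℝ) (s n : ℕ) : ℝ := ∑ l ∈ Finset.range (s + 1), t l n

/-- `υ(n, 𝕋) = ∑_{k=0}^{|n|} |ε_k(n) - ε_{k+1}(n)| τ_{2^k,n}`. -/
def upsilon (t : ℕ → ℕ → ℝ) (n : ℕ) : ℝ :=
  ∑ k ∈ Finset.range (Nat.log 2 n + 1),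
    |(binCoeff n k : ℝ) - (binCoeff n (k + 1) : ℝ)| * tau t (2 ^ k) n

/-- The norm of the dyadic Hardy space `H₁(𝕀)`: the `L₁` norm of the dyadic maximal function
`sup_n |I_n(x)|⁻¹ |∫_{I_n(x)} f|`. -/
def hardyNorm (f : ℝ → ℝ) : ℝ≥0∞ :=
  ∫⁻ x, ⨆ n : ℕ, ENNReal.ofReal (2 ^ n * |∫ u in dyadicInterval n x, f u|) ∂μI

/-- The dyadic Hardy space `H₁(𝕀)`. -/
def MemHardy (f : ℝ → ℝ) : Prop := Integrable f μI ∧ hardyNorm f < ∞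

/-- The norm of an operator from `H₁(𝕀)` to `L₁(𝕀)`. -/
def opNormHardy (T : (ℝ → ℝ) → ℝ → ℝ) : ℝ≥0∞ :=
  ⨆ (f : ℝ → ℝ) (_ : MemHardy f) (_ : hardyNorm f ≤ 1), eLpNorm (T f) 1 μI

/-- The norm of an operator from `L_∞(𝕀)` to `L_∞(𝕀)`. -/
def opNormInfty (T : (ℝ → ℝ) → ℝ → ℝ) : ℝ≥0∞ :=
  ⨆ (f : ℝ → ℝ) (_ : MemLp f ∞ μI) (_ : eLpNorm f ∞ μI ≤ 1), eLpNorm (T f) ∞ μI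

/-- The logarithmic space `L ln L(𝕀²)`. -/
def MemLLogL (f : ℝ × ℝ → ℝ) : Prop :=
  Integrable f (μI.prod μI) ∧ Integrable (fun u => |f u| * Real.posLog |f u|) (μI.prod μI)

/-- `W_{n⁰,n¹} f(x)`. -/
def lebesgueW (f : ℝ × ℝ → ℝ) (x : ℝ × ℝ) (n₀ n₁ : ℕ) : ℝ :=
  ∑ i ∈ Finset.range (n₀ + 1), ∑ j ∈ Finset.range (n₁ + 1), (2 : ℝ) ^ (i + j) *
    ∫ s in dyadicInterval n₀ (dyadicAdd x.1 (1 / 2 ^ (i + 1))) ×ˢ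
      dyadicInterval n₁ (dyadicAdd x.2 (1 / 2 ^ (j + 1))), |f s - f x|

/-- `H^{(0)}_n f(x)`. -/
def lebesgueH₀ (f : ℝ × ℝ → ℝ) (x : ℝ × ℝ) (n : ℕ) : ℝ :=
  ∑ i ∈ Finset.range (n + 1), (2 : ℝ) ^ i *
    ∫ s in dyadicInterval n (dyadicAdd x.1 (1 / 2 ^ (i + 1))) ×ˢ unitI, |f s - f x|

/-- `H^{(1)}_n f(x)`. -/
def lebesgueH₁ (f : ℝ × ℝ → ℝ) (x : ℝ × ℝ) (n : ℕ) : ℝ :=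
  ∑ i ∈ Finset.range (n + 1), (2 : ℝ) ^ i *
    ∫ s in unitI ×ˢ dyadicInterval n (dyadicAdd x.2 (1 / 2 ^ (i + 1))), |f s - f x|

/-- Two-dimensional Walsh-Lebesgue points of an integrable function `f` on `𝕀²`. -/
structure IsWalshLebesguePoint (f : ℝ × ℝ → ℝ) (x : ℝ × ℝ) : Prop where
  mem : x ∈ unitI ×ˢ unitI
  tendsto_W : Tendsto (fun m : ℕ × ℕ => lebesgueW f x m.1 m.2)
    (comap (fun m : ℕ × ℕ => min m.1 m.2) atTop) (𝓝 0)
  bdd_H₁ : BddAbove (Set.range (lebesgueH₁ f x))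
  bdd_H₀ : BddAbove (Set.range (lebesgueH₀ f x))

end WalshPaley

end

/-! The proof dominates the kernels `V_n` pointwise. Write `G_s = ∑_{i ≤ s} 2^i 1_{I_s(2^{-i-1})}`.
Then `|V_n| ≤ ∑_s c_s(n) G_s` with `c_s(n) ≥ 0`, `∑_s c_s(n) ≤ 5 + 4 υ(n, 𝕋)`, and `c_s(n) → 0` for
each fixed `s` as soon as `t_{0,n} → 0`. Integrating `|f - f(x)|` against the dyadic translate by
`x` of `G_A ⊗ G_B` gives exactly `W_{A,B} f(x)`. So the deviation of the mean from `f(x)` is at most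
`∑∑ c_A c_B W_{A,B} f(x)` plus `|f(x)|` times a mass defect that tends to zero. The double sum tends
to zero by a Toeplitz argument: `W_{A,B}` is small when both indices are large; when one index is
bounded, the suprema of `H^{(0)}`, `H^{(1)}` bound `W_{A,B}` uniformly in the other, and the
coefficients of the bounded index vanish in the limit.

The domination comes from peeling off the leading binary digit, `n = 2^A + m`. Reversing the lower
half of the sum through `D_{2^A-j} = D_{2^A} - w_{2^A-1} D_j` yields a recursion from `V_n` to the
kernel of index `m` with the same weights (`IsSign.signKernel_two_pow_add`). Unfolded, it reads `V_n
= w_n · (principal part) + error`. The error is controlled by Fejér-type sums at total cost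
independent of `υ`. The principal part is a combination of the differences `D_{2^{A+1}} - D_{2^A}`
over the digits one of `n`, and Abel summation turns its coefficients into the digit jumps that
define `υ`.

Conditions (i) and (ii) both imply (iii), because `υ(n, 𝕋) ≤ 8 ‖V_n‖₁ + 64`: near the origin the
principal part exhibits the digit jumps one scale at a time (`sum_abs_sub_mul_le`). The norm
`‖V_n‖₁` is bounded by the `L_∞` operator norm by testing on the sign of `V_n`. For `H₁`, the test
function is the atom `r_A D_{2^A}`, on which the mean acts as `r_A` times the kernel of index `m`;
the recursion then recovers `V_n` up to a bounded `L₁` error. -/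

noncomputable section

namespace WalshPaley

/-! ### Binary digits of the index. -/

section Bits

theorem binCoeff_eq_zero_or_one (n k : ℕ) : binCoeff n k = 0 ∨ binCoeff n k = 1 := by
  unfold binCoeff; omega

theorem binCoeff_of_lt {n k : ℕ} (h : n < 2 ^ k) : binCoeff n k = 0 := by
  simp [binCoeff, Nat.div_eq_of_lt h]

theorem binCoeff_two_pow_add {A m : ℕ} (hm : m < 2 ^ A) : binCoeff (2 ^ A + m) A = 1 := by
  have : (2 ^ A + m) / 2 ^ A = 1 := by
    rw [Nat.add_div_left _ (by positivity), Nat.div_eq_of_lt hm]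
  simp [binCoeff, this]

theorem binCoeff_two_pow_add_of_lt {A m k : ℕ} (hk : k < A) :
    binCoeff (2 ^ A + m) k = binCoeff m k := by
  obtain ⟨c, rfl⟩ := Nat.exists_eq_add_of_lt hk
  have : 2 ^ (k + c + 1) + m = m + 2 ^ k * (2 * 2 ^ c) := by ring
  simp only [binCoeff]
  rw [this, Nat.add_mul_div_left _ _ (by positivity)]
  omega

theorem two_pow_add_mod {A m k : ℕ} (hk : k ≤ A) : (2 ^ A + m) % 2 ^ k = m % 2 ^ k := by
  obtain ⟨c, rfl⟩ := Nat.exists_eq_add_of_le hk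
  rw [pow_add, Nat.mul_add_mod]

theorem mod_two_pow_succ_eq (n A : ℕ) :
    n % 2 ^ (A + 1) = n % 2 ^ A + 2 ^ A * binCoeff n A := by
  rw [pow_succ, Nat.mod_mul]; rfl

theorem exists_two_pow_add {A n : ℕ} (h1 : 2 ^ A ≤ n) (h2 : n < 2 ^ (A + 1)) :
    ∃ m, m < 2 ^ A ∧ n = 2 ^ A + m :=
  ⟨n - 2 ^ A, by rw [pow_succ] at h2; omega, by omega⟩

end Bits

/-! ### Walsh functions and Dirichlet kernels as functions of Rademacher signs. -/

/-- The Walsh function of index `n`, as a function of the values of the Rademacher functions. -/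
def signWalsh (r : ℕ → ℝ) (n : ℕ) : ℝ :=
  ∏ k ∈ Finset.range (Nat.log 2 n + 1), r k ^ binCoeff n k

/-- The Walsh-Dirichlet kernel as a function of the values of the Rademacher functions. -/
def signDirichlet (r : ℕ → ℝ) (k : ℕ) : ℝ := ∑ j ∈ Finset.range k, signWalsh r j

/-- The Walsh-Dirichlet kernel of index `2 ^ A`. -/
def signDyadic (r : ℕ → ℝ) (A : ℕ) : ℝ := ∏ k ∈ Finset.range A, (1 + r k)

/-- The majorant `∑_{i ≤ A} 2 ^ i 1_{I_A(2 ^ (-i - 1))}` of the Walsh-Fejér kernels. -/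
def signFejerMajorant (r : ℕ → ℝ) : ℕ → ℝ
  | 0 => 1
  | A + 1 => (1 + r A) / 2 * signFejerMajorant r A + signDyadic r A

/-- The kernel `∑_{k ≤ n} t_{n-k} D_k`. -/
def signKernel (r : ℕ → ℝ) (t : ℕ → ℝ) (n : ℕ) : ℝ :=
  ∑ k ∈ Finset.range (n + 1), t (n - k) * signDirichlet r k

/-- `r` takes the values `1` and `-1` only. -/
def IsSign (r : ℕ → ℝ) : Prop := ∀ k, r k = 1 ∨ r k = -1

theorem IsSign.mul_self {r : ℕ → ℝ} (hr : IsSign r) (k : ℕ) : r k * r k = 1 := by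
  rcases hr k with h | h <;> simp [h]

theorem IsSign.abs_eq {r : ℕ → ℝ} (hr : IsSign r) (k : ℕ) : |r k| = 1 := by
  rcases hr k with h | h <;> simp [h]

theorem IsSign.one_add_nonneg {r : ℕ → ℝ} (hr : IsSign r) (k : ℕ) : 0 ≤ 1 + r k := by
  rcases hr k with h | h <;> norm_num [h]

theorem signWalsh_eq_prod (r : ℕ → ℝ) {n L : ℕ} (h : n < 2 ^ L) :
    signWalsh r n = ∏ k ∈ Finset.range L, r k ^ binCoeff n k := by
  have key : ∀ L', n < 2 ^ L' → ∀ c, ∏ k ∈ Finset.range (L' + c), r k ^ binCoeff n k =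
      ∏ k ∈ Finset.range L', r k ^ binCoeff n k := by
    intro L' h' c
    induction c with
    | zero => rfl
    | succ c ih =>
      rw [← add_assoc, Finset.prod_range_succ, ih, binCoeff_of_lt, pow_zero, mul_one]
      exact h'.trans_le (Nat.pow_le_pow_right (by norm_num) (by omega))
  have h2 : n < 2 ^ (Nat.log 2 n + 1) := Nat.lt_pow_succ_log_self (by norm_num) n
  unfold signWalsh
  rw [← key _ h2 L, ← key _ h (Nat.log 2 n + 1), add_comm]

theorem signWalsh_zero (r : ℕ → ℝ) : signWalsh r 0 = 1 := by
  rw [signWalsh_eq_prod r (L := 0) (by norm_num)]; simp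

theorem signWalsh_two_pow_add (r : ℕ → ℝ) {A m : ℕ} (hm : m < 2 ^ A) :
    signWalsh r (2 ^ A + m) = r A * signWalsh r m := by
  rw [signWalsh_eq_prod r (L := A + 1) (by rw [pow_succ]; omega), signWalsh_eq_prod r hm,
    Finset.prod_range_succ, binCoeff_two_pow_add hm, pow_one, mul_comm]
  congr 1
  refine Finset.prod_congr rfl fun k hk => ?_
  rw [binCoeff_two_pow_add_of_lt (Finset.mem_range.1 hk)]

theorem IsSign.signWalsh_eq {r : ℕ → ℝ} (hr : IsSign r) (n : ℕ) :
    signWalsh r n = 1 ∨ signWalsh r n = -1 := by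
  unfold signWalsh
  refine Finset.prod_induction _ (fun z : ℝ => z = 1 ∨ z = -1) ?_ (Or.inl rfl) ?_
  · rintro a b (rfl | rfl) (rfl | rfl) <;> simp
  · intro k _
    rcases binCoeff_eq_zero_or_one n k with h | h
    · simp [h]
    · simpa [h] using hr k

theorem IsSign.abs_signWalsh {r : ℕ → ℝ} (hr : IsSign r) (n : ℕ) : |signWalsh r n| = 1 := by
  rcases hr.signWalsh_eq n with h | h <;> simp [h]

theorem signDirichlet_zero (r : ℕ → ℝ) : signDirichlet r 0 = 0 := by simp [signDirichlet]

theorem signDirichlet_two_pow_add' (r : ℕ → ℝ) {A m : ℕ} (hm : m ≤ 2 ^ A) :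
    signDirichlet r (2 ^ A + m) = signDirichlet r (2 ^ A) + r A * signDirichlet r m := by
  unfold signDirichlet
  rw [Finset.sum_range_add, Finset.mul_sum]
  congr 1
  refine Finset.sum_congr rfl fun j hj => ?_
  rw [signWalsh_two_pow_add r (by have := Finset.mem_range.1 hj; omega)]

theorem signDirichlet_two_pow (r : ℕ → ℝ) (A : ℕ) :
    signDirichlet r (2 ^ A) = signDyadic r A := by
  induction A with
  | zero => simp [signDirichlet, signDyadic, signWalsh_zero]
  | succ A ih =>
    rw [pow_succ, mul_two, signDirichlet_two_pow_add' r le_rfl, ih, signDyadic, signDyadic,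
      Finset.prod_range_succ]
    ring

theorem signDirichlet_two_pow_add (r : ℕ → ℝ) {A m : ℕ} (hm : m ≤ 2 ^ A) :
    signDirichlet r (2 ^ A + m) = signDyadic r A + r A * signDirichlet r m := by
  rw [signDirichlet_two_pow_add' r hm, signDirichlet_two_pow]

theorem signDyadic_succ (r : ℕ → ℝ) (A : ℕ) :
    signDyadic r (A + 1) = (1 + r A) * signDyadic r A := by
  rw [signDyadic, Finset.prod_range_succ, mul_comm]; rfl

theorem IsSign.signDyadic_nonneg {r : ℕ → ℝ} (hr : IsSign r) (A : ℕ) : 0 ≤ signDyadic r A :=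
  Finset.prod_nonneg fun k _ => hr.one_add_nonneg k

theorem IsSign.signFejerMajorant_nonneg {r : ℕ → ℝ} (hr : IsSign r) (A : ℕ) :
    0 ≤ signFejerMajorant r A := by
  induction A with
  | zero => simp [signFejerMajorant]
  | succ A ih =>
    have := hr.one_add_nonneg A
    have := hr.signDyadic_nonneg A
    rw [signFejerMajorant]; positivity

theorem IsSign.signDyadic_le_signFejerMajorant {r : ℕ → ℝ} (hr : IsSign r) (A : ℕ) :
    signDyadic r A ≤ signFejerMajorant r A := by
  induction A with
  | zero => simp [signFejerMajorant, signDyadic]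
  | succ A ih =>
    have h1 := hr.signDyadic_nonneg A
    rw [signFejerMajorant, signDyadic_succ]
    rcases hr A with h | h <;> rw [h] <;> linarith

/-- The product `∏ (1 + r k)` vanishes unless all `r k` with `k < A` equal one, and there every
Walsh function of index below `2 ^ A` is one. -/
theorem IsSign.signDyadic_mul_signWalsh {r : ℕ → ℝ} (hr : IsSign r) {A j : ℕ} (hj : j < 2 ^ A) :
    signDyadic r A * signWalsh r j = signDyadic r A := by
  induction A generalizing j with
  | zero =>
    obtain rfl : j = 0 := by simpa using hj
    rw [signWalsh_zero, mul_one]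
  | succ A ih =>
    rw [signDyadic_succ]
    rcases lt_or_ge j (2 ^ A) with h | h
    · rw [mul_assoc, ih h]
    · obtain ⟨m, hm, rfl⟩ := exists_two_pow_add h hj
      rw [signWalsh_two_pow_add r hm]
      have h2 := hr.mul_self A
      linear_combination (1 + r A) * r A * ih hm + signDyadic r A * h2

/-- The digits of `2 ^ A - 1 - l` are the complements of those of `l`, and `r k * r k = 1`. -/
theorem IsSign.signWalsh_reflect {r : ℕ → ℝ} (hr : IsSign r) {A l : ℕ} (hl : l < 2 ^ A) :
    signWalsh r (2 ^ A - 1 - l) = signWalsh r (2 ^ A - 1) * signWalsh r l := by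
  induction A generalizing l with
  | zero =>
    obtain rfl : l = 0 := by simpa using hl
    simp [signWalsh_zero]
  | succ A ih =>
    have hp : 0 < 2 ^ A := by positivity
    have e : 2 ^ (A + 1) - 1 = 2 ^ A + (2 ^ A - 1) := by rw [pow_succ]; omega
    rw [e, signWalsh_two_pow_add r (m := 2 ^ A - 1) (by omega)]
    rcases lt_or_ge l (2 ^ A) with h | h
    · have e2 : 2 ^ A + (2 ^ A - 1) - l = 2 ^ A + (2 ^ A - 1 - l) := by omega
      rw [e2, signWalsh_two_pow_add r (by omega), ih h, mul_assoc]
    · obtain ⟨m, hm, rfl⟩ := exists_two_pow_add h hl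
      have e2 : 2 ^ A + (2 ^ A - 1) - (2 ^ A + m) = 2 ^ A - 1 - m := by omega
      rw [e2, signWalsh_two_pow_add r hm, ih hm]
      have h2 := hr.mul_self A
      linear_combination -signWalsh r (2 ^ A - 1) * signWalsh r m * h2

/-- The `j` last Walsh functions below `2 ^ A`, read backwards, are `w_{2^A-1}` times the `j` first.
-/
theorem IsSign.signDirichlet_reflect {r : ℕ → ℝ} (hr : IsSign r) {A j : ℕ} (hj : j ≤ 2 ^ A) :
    signDirichlet r (2 ^ A - j) =
      signDyadic r A - signWalsh r (2 ^ A - 1) * signDirichlet r j := by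
  induction j with
  | zero => simp [signDirichlet_zero, signDirichlet_two_pow]
  | succ j ih =>
    have h1 := ih (by omega)
    have e : 2 ^ A - j = (2 ^ A - (j + 1)) + 1 := by omega
    have e2 : 2 ^ A - (j + 1) = 2 ^ A - 1 - j := by omega
    rw [e, signDirichlet, Finset.sum_range_succ, e2, hr.signWalsh_reflect (by omega)] at h1
    rw [e2, signDirichlet, signDirichlet, Finset.sum_range_succ]
    rw [signDirichlet] at h1
    linarith

/-! ### Fejér-type sums and their weighted versions. -/

section Fejer

theorem sum_signDirichlet_two_pow_add (r : ℕ → ℝ) {A m : ℕ} (hm : m ≤ 2 ^ A) :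
    ∑ k ∈ Finset.range (2 ^ A + m), signDirichlet r k =
      ∑ k ∈ Finset.range (2 ^ A), signDirichlet r k + m * signDyadic r A +
        r A * ∑ k ∈ Finset.range m, signDirichlet r k := by
  rw [Finset.sum_range_add, add_assoc, Finset.mul_sum]
  congr 1
  rw [Finset.sum_congr rfl fun k hk => signDirichlet_two_pow_add r
    (by have := Finset.mem_range.1 hk; omega : k ≤ 2 ^ A), Finset.sum_add_distrib]
  simp

/-- With `F_A` the sum, `F_{A+1} = (1 + r_A) F_A + 2^A D_{2^A}`. The quantity `2^A G_A` obeys the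
same recursion with the last term doubled. -/
theorem IsSign.abs_sum_signDirichlet_two_pow {r : ℕ → ℝ} (hr : IsSign r) (A : ℕ) :
    |∑ k ∈ Finset.range (2 ^ A), signDirichlet r k| ≤ 2 ^ A * signFejerMajorant r A := by
  induction A with
  | zero => simp [signDirichlet_zero, signFejerMajorant]
  | succ A ih =>
    have h1 := hr.signDyadic_nonneg A
    rw [pow_succ, mul_two, sum_signDirichlet_two_pow_add r le_rfl, signFejerMajorant]
    set F := ∑ k ∈ Finset.range (2 ^ A), signDirichlet r k
    have h3 : 0 ≤ (2 : ℝ) ^ A * signDyadic r A := by positivity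
    push_cast
    rw [abs_le] at ih ⊢
    rcases hr A with h | h <;> rw [h, pow_succ] <;> constructor <;> nlinarith

/-- Each digit one of `n` at place `s` contributes a full dyadic block and a multiple of `D_{2^s}`,
both at most `2^s G_s`; hence the factor `2`. Summing over all `s` with `2 ^ s ≤ n`, rather than
over the digits one, makes the bound nondecreasing in `n` with jumps at powers of two only, as suits
Abel summation. -/
theorem IsSign.abs_sum_signDirichlet {r : ℕ → ℝ} (hr : IsSign r) {A n : ℕ} (hn : n < 2 ^ A) :
    |∑ k ∈ Finset.range n, signDirichlet r k| ≤
      ∑ s ∈ Finset.range A, if 2 ^ s ≤ n then 2 * (2 ^ s * signFejerMajorant r s) else 0 := by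
  induction A generalizing n with
  | zero =>
    obtain rfl : n = 0 := by simpa using hn
    simp
  | succ A ih =>
    rw [Finset.sum_range_succ]
    rcases lt_or_ge n (2 ^ A) with h | h
    · rw [if_neg (by omega), add_zero]; exact ih h
    · rw [if_pos h]
      obtain ⟨m, hm, rfl⟩ := exists_two_pow_add h hn
      rw [sum_signDirichlet_two_pow_add r hm.le]
      have h1 := ih hm
      have h2 := hr.abs_sum_signDirichlet_two_pow A
      have h3 : ∑ s ∈ Finset.range A,
          (if 2 ^ s ≤ m then 2 * (2 ^ s * signFejerMajorant r s) else 0) ≤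
          ∑ s ∈ Finset.range A,
            if 2 ^ s ≤ 2 ^ A + m then 2 * (2 ^ s * signFejerMajorant r s) else 0 := by
        refine Finset.sum_le_sum fun s _ => ?_
        have := hr.signFejerMajorant_nonneg s
        split_ifs
        · exact le_rfl
        · omega
        · positivity
        · exact le_rfl
      have h4 : (m : ℝ) * signDyadic r A ≤ 2 ^ A * signFejerMajorant r A :=
        mul_le_mul (by exact_mod_cast hm.le) (hr.signDyadic_le_signFejerMajorant A)
          (hr.signDyadic_nonneg A) (by positivity)
      have h5 : 0 ≤ (m : ℝ) * signDyadic r A := mul_nonneg (by positivity) (hr.signDyadic_nonneg A)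
      refine (abs_add_le _ _).trans ?_
      rw [abs_mul, hr.abs_eq, one_mul]
      have h6 := abs_add_le (∑ k ∈ Finset.range (2 ^ A), signDirichlet r k) (m * signDyadic r A)
      rw [abs_of_nonneg h5] at h6
      linarith

/-- Summation by parts for a nonincreasing weight. -/
theorem abs_sum_mul_le_of_antitone {t D Φ : ℕ → ℝ} (ht0 : ∀ k, 0 ≤ t k) (ht : Antitone t)
    {N : ℕ} (hΦ : Φ 0 = 0) (h : ∀ n ≤ N, |∑ k ∈ Finset.range n, D k| ≤ Φ n) :
    |∑ j ∈ Finset.range N, t j * D j| ≤ ∑ j ∈ Finset.range N, t j * (Φ (j + 1) - Φ j) := by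
  have key : ∀ (E : ℕ → ℝ), E 0 = 0 → ∀ n, ∑ j ∈ Finset.range n, t j * (E (j + 1) - E j) =
      t n * E n + ∑ j ∈ Finset.range n, (t j - t (j + 1)) * E (j + 1) := by
    intro E hE n
    induction n with
    | zero => simp [hE]
    | succ n ih => rw [Finset.sum_range_succ, ih, Finset.sum_range_succ]; ring
  have h1 := key (fun n => ∑ k ∈ Finset.range n, D k) (by simp) N
  simp only [Finset.sum_range_succ, add_sub_cancel_left] at h1
  rw [h1, key Φ hΦ N]
  refine (abs_add_le _ _).trans (add_le_add ?_ ((Finset.abs_sum_le_sum_abs _ _).trans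
    (Finset.sum_le_sum fun j hj => ?_)))
  · rw [abs_mul, abs_of_nonneg (ht0 N)]
    exact mul_le_mul_of_nonneg_left (h N le_rfl) (ht0 N)
  · have := ht (Nat.le_succ j)
    rw [← Finset.sum_range_succ, abs_mul, abs_of_nonneg (sub_nonneg.2 this)]
    exact mul_le_mul_of_nonneg_left (h _ (Finset.mem_range.1 hj)) (sub_nonneg.2 this)

theorem IsSign.abs_sum_mul_signDirichlet {r : ℕ → ℝ} (hr : IsSign r) {t : ℕ → ℝ}
    (ht0 : ∀ k, 0 ≤ t k) (ht : Antitone t) (A : ℕ) :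
    |∑ j ∈ Finset.range (2 ^ A), t j * signDirichlet r j| ≤
      ∑ s ∈ Finset.range (A + 1), 2 * (2 ^ s * t (2 ^ s - 1)) * signFejerMajorant r s := by
  refine (abs_sum_mul_le_of_antitone (Φ := fun n => ∑ s ∈ Finset.range (A + 1),
    if 2 ^ s ≤ n then 2 * (2 ^ s * signFejerMajorant r s) else 0) ht0 ht ?_ ?_).trans ?_
  · refine Finset.sum_eq_zero fun s _ => if_neg ?_
    have : 0 < 2 ^ s := by positivity
    omega
  · intro n hn
    exact hr.abs_sum_signDirichlet (by rw [pow_succ]; have : 0 < 2 ^ A := by positivity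
                                       omega)
  · simp only [← Finset.sum_sub_distrib, Finset.mul_sum]
    rw [Finset.sum_comm]
    refine Finset.sum_le_sum fun s hs => ?_
    have hp : 0 < 2 ^ s := by positivity
    have hsA : 2 ^ s ≤ 2 ^ A :=
      Nat.pow_le_pow_right (by norm_num) (by have := Finset.mem_range.1 hs; omega)
    -- The `s`-th threshold is crossed only in passing from `j = 2 ^ s - 1` to `j + 1`, so only that
    -- weight survives.
    rw [Finset.sum_eq_single_of_mem (2 ^ s - 1) (Finset.mem_range.2 (by omega))]
    · rw [if_pos (by omega), if_neg (by omega)]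
      apply le_of_eq; ring
    · intro j _ hj
      by_cases h : 2 ^ s ≤ j
      · rw [if_pos h, if_pos (by omega)]; ring
      · rw [if_neg h, if_neg (by omega)]; ring

end Fejer

/-! ### Principal part and error of the kernel. -/

/-- The terms of index at least `2 ^ A` are shifted by `D_{2^A+k} = D_{2^A} + r_A D_k` and rebuild
the kernel of index `m`; those below are reflected. The two contributions of `D_{2^A}` merge into
the total weight. -/
theorem IsSign.signKernel_two_pow_add {r : ℕ → ℝ} (hr : IsSign r) (t : ℕ → ℝ) {A m : ℕ}
    (hm : m < 2 ^ A) :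
    signKernel r t (2 ^ A + m) =
      (∑ l ∈ Finset.range (2 ^ A + m), t l) * signDyadic r A -
      signWalsh r (2 ^ A - 1) * ∑ j ∈ Finset.range (2 ^ A), t (m + j) * signDirichlet r j +
      r A * signKernel r t m := by
  unfold signKernel
  rw [add_assoc, Finset.sum_range_add]
  have h1 : ∑ k ∈ Finset.range (m + 1), t (2 ^ A + m - (2 ^ A + k)) * signDirichlet r (2 ^ A + k) =
      (∑ l ∈ Finset.range (m + 1), t l) * signDyadic r A +
        r A * ∑ k ∈ Finset.range (m + 1), t (m - k) * signDirichlet r k := by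
    rw [← Finset.sum_range_reflect t, Finset.sum_mul, Finset.mul_sum, ← Finset.sum_add_distrib]
    refine Finset.sum_congr rfl fun k hk => ?_
    have := Finset.mem_range.1 hk
    rw [signDirichlet_two_pow_add r (by omega), Nat.add_sub_add_left,
      show m + 1 - 1 - k = m - k by omega]
    ring
  -- Under `j = 2 ^ A - k` the range becomes `1, …, 2 ^ A`. The end `j = 2 ^ A` contributes `D_0 =
  -- 0`; the added term `j = 0` is the one subtracted.
  have h2 : ∑ k ∈ Finset.range (2 ^ A), t (2 ^ A + m - k) * signDirichlet r k =
      ∑ j ∈ Finset.range (2 ^ A), t (m + j) * signDirichlet r (2 ^ A - j) -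
        t m * signDyadic r A := by
    have h3 : ∑ j ∈ Finset.range (2 ^ A + 1), t (m + j) * signDirichlet r (2 ^ A - j) =
        ∑ j ∈ Finset.range (2 ^ A), t (m + j) * signDirichlet r (2 ^ A - j) := by
      rw [Finset.sum_range_succ, Nat.sub_self, signDirichlet_zero, mul_zero, add_zero]
    rw [← h3, Finset.sum_range_succ', ← Finset.sum_range_reflect, Nat.sub_zero,
      signDirichlet_two_pow, add_zero, add_sub_cancel_right]
    refine Finset.sum_congr rfl fun k hk => ?_
    have := Finset.mem_range.1 hk
    congr 2 <;> omega
  have h4 : ∑ j ∈ Finset.range (2 ^ A), t (m + j) * signDirichlet r (2 ^ A - j) =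
      (∑ j ∈ Finset.range (2 ^ A), t (m + j)) * signDyadic r A -
        signWalsh r (2 ^ A - 1) * ∑ j ∈ Finset.range (2 ^ A), t (m + j) * signDirichlet r j := by
    rw [Finset.sum_mul, Finset.mul_sum, ← Finset.sum_sub_distrib]
    refine Finset.sum_congr rfl fun j hj => ?_
    rw [hr.signDirichlet_reflect (Finset.mem_range.1 hj).le]
    ring
  rw [h1, h2, h4, Finset.sum_range_succ t m, add_comm (2 ^ A) m, Finset.sum_range_add t]
  ring

/-- The principal part of the kernel `∑_{k ≤ n} t_{n-k} D_k` for `n < 2 ^ L`, up to the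
factor `w_n`. -/
def signPrincipal (r : ℕ → ℝ) (t : ℕ → ℝ) (n L : ℕ) : ℝ :=
  ∑ A ∈ Finset.range L, binCoeff n A * (∑ l ∈ Finset.range (n % 2 ^ (A + 1)), t l) *
    (signDyadic r (A + 1) - signDyadic r A)

/-- The recursion is iterated over the digits of `n`. Since `D_{2^{A+1}} - D_{2^A} = r_A D_{2^A}`
and `D_{2^A}` absorbs `w_m`, the new term `T D_{2^A}` equals `w_n T (D_{2^{A+1}} - D_{2^A})`; only
the reflected sums remain in the error. -/
theorem IsSign.abs_signKernel_sub_signPrincipal {r : ℕ → ℝ} (hr : IsSign r) {t : ℕ → ℝ}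
    (ht0 : ∀ k, 0 ≤ t k) (ht : Antitone t) {n L : ℕ} (hn : n < 2 ^ L) :
    |signKernel r t n - signWalsh r n * signPrincipal r t n L| ≤
      ∑ A ∈ Finset.range L, binCoeff n A * ∑ s ∈ Finset.range (A + 1),
        2 * (2 ^ s * t (n % 2 ^ A + (2 ^ s - 1))) * signFejerMajorant r s := by
  induction L generalizing n with
  | zero =>
    obtain rfl : n = 0 := by simpa using hn
    simp [signKernel, signPrincipal, signDirichlet_zero]
  | succ A ih =>
    rw [Finset.sum_range_succ, signPrincipal, Finset.sum_range_succ]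
    rcases lt_or_ge n (2 ^ A) with h | h
    · simp only [binCoeff_of_lt h, Nat.cast_zero, zero_mul, add_zero]
      exact ih h
    · obtain ⟨m, hm, rfl⟩ := exists_two_pow_add h hn
      have e1 : ∑ B ∈ Finset.range A, (binCoeff (2 ^ A + m) B : ℝ) *
          (∑ l ∈ Finset.range ((2 ^ A + m) % 2 ^ (B + 1)), t l) *
          (signDyadic r (B + 1) - signDyadic r B) = signPrincipal r t m A := by
        refine Finset.sum_congr rfl fun B hB => ?_
        have := Finset.mem_range.1 hB
        rw [binCoeff_two_pow_add_of_lt this, two_pow_add_mod (by omega)]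
      have e2 : ∑ B ∈ Finset.range A, (binCoeff (2 ^ A + m) B : ℝ) *
          ∑ s ∈ Finset.range (B + 1),
          2 * (2 ^ s * t ((2 ^ A + m) % 2 ^ B + (2 ^ s - 1))) * signFejerMajorant r s =
          ∑ B ∈ Finset.range A, (binCoeff m B : ℝ) * ∑ s ∈ Finset.range (B + 1),
          2 * (2 ^ s * t (m % 2 ^ B + (2 ^ s - 1))) * signFejerMajorant r s := by
        refine Finset.sum_congr rfl fun B hB => ?_
        have := Finset.mem_range.1 hB
        rw [binCoeff_two_pow_add_of_lt this, two_pow_add_mod (by omega)]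
      rw [e1, e2, binCoeff_two_pow_add hm, two_pow_add_mod le_rfl, Nat.mod_eq_of_lt hm,
        Nat.mod_eq_of_lt hn, hr.signKernel_two_pow_add t hm, signWalsh_two_pow_add r hm]
      have h1 := ih hm
      have h2 := hr.abs_sum_mul_signDirichlet (t := fun j => t (m + j)) (fun k => ht0 _)
        (fun a b hab => ht (by omega)) A
      set S := ∑ j ∈ Finset.range (2 ^ A), t (m + j) * signDirichlet r j
      set T := ∑ l ∈ Finset.range (2 ^ A + m), t l
      have e3 : signWalsh r m * signDyadic r A = signDyadic r A := by
        rw [mul_comm, hr.signDyadic_mul_signWalsh hm]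
      have e4 : T * signDyadic r A - signWalsh r (2 ^ A - 1) * S + r A * signKernel r t m -
          r A * signWalsh r m * (signPrincipal r t m A + ((1 : ℕ) : ℝ) * T *
            (signDyadic r (A + 1) - signDyadic r A)) =
          r A * (signKernel r t m - signWalsh r m * signPrincipal r t m A) -
            signWalsh r (2 ^ A - 1) * S := by
        rw [signDyadic_succ, Nat.cast_one]
        linear_combination (-T * signWalsh r m * signDyadic r A) * hr.mul_self A - T * e3
      rw [e4, Nat.cast_one, one_mul]
      refine (abs_sub _ _).trans ?_
      rw [abs_mul, abs_mul, hr.abs_eq, hr.abs_signWalsh, one_mul, one_mul]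
      exact add_le_add h1 h2

/-! ### Coefficients of the kernel majorant: total mass and decay. -/

section Weights

variable {t : ℕ → ℝ}

theorem sum_range_mono (ht0 : ∀ k, 0 ≤ t k) {a b : ℕ} (h : a ≤ b) :
    ∑ l ∈ Finset.range a, t l ≤ ∑ l ∈ Finset.range b, t l :=
  Finset.sum_le_sum_of_subset_of_nonneg (Finset.range_mono h) fun k _ _ => ht0 k

theorem sum_range_two_mul_le (ht : Antitone t) (k : ℕ) :
    ∑ l ∈ Finset.range (2 * k), t l ≤ 2 * ∑ l ∈ Finset.range k, t l := by
  rw [two_mul, Finset.sum_range_add, two_mul]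
  exact add_le_add le_rfl (Finset.sum_le_sum fun l _ => ht (by omega))

theorem sum_range_le_mul (ht : Antitone t) (k : ℕ) :
    ∑ l ∈ Finset.range k, t l ≤ k * t 0 := by
  simpa using Finset.sum_le_card_nsmul (Finset.range k) t (t 0) fun l _ => ht (Nat.zero_le l)

theorem mul_le_sum_range (ht : Antitone t) (k : ℕ) :
    k * t (k - 1) ≤ ∑ l ∈ Finset.range k, t l := by
  simpa using Finset.card_nsmul_le_sum (Finset.range k) t (t (k - 1))
    fun l hl => ht (by have := Finset.mem_range.1 hl; omega)

theorem sum_two_pow_mul_le (ht0 : ∀ k, 0 ≤ t k) (ht : Antitone t) (A : ℕ) :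
    ∑ s ∈ Finset.range (A + 1), 2 ^ s * t (2 ^ s - 1) ≤ 2 * ∑ l ∈ Finset.range (2 ^ A), t l := by
  induction A with
  | zero => simp; linarith [ht0 0]
  | succ A ih =>
    rw [Finset.sum_range_succ, show (2 : ℕ) ^ (A + 1) = 2 ^ A + 2 ^ A by ring,
      Finset.sum_range_add t]
    have h := Finset.card_nsmul_le_sum (Finset.range (2 ^ A)) (fun j => t (2 ^ A + j))
      (t (2 ^ A + 2 ^ A - 1)) fun l hl => ht (by have := Finset.mem_range.1 hl; omega)
    simp only [Finset.card_range, nsmul_eq_mul, Nat.cast_pow, Nat.cast_ofNat] at h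
    rw [pow_succ]
    linarith

/-- The value of `|ε_A - ε_{A+1}|` controls the difference of the coefficients of the
principal part. -/
theorem abs_sub_principal_le (ht0 : ∀ k, 0 ≤ t k) (ht : Antitone t) (n A : ℕ) :
    |binCoeff n A * (∑ l ∈ Finset.range (n % 2 ^ (A + 1)), t l) -
      binCoeff n (A + 1) * ∑ l ∈ Finset.range (n % 2 ^ (A + 2)), t l| ≤
    4 * (|(binCoeff n A : ℝ) - binCoeff n (A + 1)| * ∑ l ∈ Finset.range (2 ^ A + 1), t l) +
      (∑ l ∈ Finset.range (n % 2 ^ (A + 2)), t l - ∑ l ∈ Finset.range (n % 2 ^ (A + 1)), t l) := by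
  have e := mod_two_pow_succ_eq n (A + 1)
  rw [add_assoc, one_add_one_eq_two] at e
  have hp : 0 ≤ ∑ l ∈ Finset.range (n % 2 ^ (A + 1)), t l := Finset.sum_nonneg fun l _ => ht0 l
  have hp2 : 0 ≤ ∑ l ∈ Finset.range (n % 2 ^ (A + 2)), t l := Finset.sum_nonneg fun l _ => ht0 l
  have hmono := sum_range_mono ht0 (show n % 2 ^ (A + 1) ≤ n % 2 ^ (A + 2) by rw [e]; omega)
  have h1 : n % 2 ^ (A + 1) ≤ 2 * 2 ^ A := by
    rw [← pow_succ']; exact (Nat.mod_lt _ (by positivity)).le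
  have h2 : n % 2 ^ (A + 2) ≤ 2 * (2 * 2 ^ A) := by
    rw [← pow_succ', ← pow_succ']; exact (Nat.mod_lt _ (by positivity)).le
  have h3 := sum_range_two_mul_le ht (2 * 2 ^ A)
  have h4 := sum_range_two_mul_le ht (2 ^ A)
  have h5 := sum_range_mono ht0 (Nat.le_succ (2 ^ A))
  have h6 := (sum_range_mono ht0 h1).trans h4
  have h7 := (sum_range_mono ht0 h2).trans h3
  have h8 : 0 ≤ ∑ l ∈ Finset.range (2 ^ A), t l := Finset.sum_nonneg fun l _ => ht0 l
  rw [Nat.succ_eq_add_one] at h5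
  -- Unequal digits cost at most the weight of `4 * 2 ^ A` terms, which two doublings bound by four
  -- times that of `2 ^ A` terms. Two digits one leave only the increment, which telescopes in `A`.
  rcases binCoeff_eq_zero_or_one n A with ha | ha <;>
    rcases binCoeff_eq_zero_or_one n (A + 1) with hb | hb <;>
    simp only [ha, hb, Nat.cast_zero, Nat.cast_one, zero_mul, one_mul, sub_self, abs_zero,
      sub_zero, zero_sub, abs_neg, abs_one, mul_zero, zero_add]
  · linarith
  · rw [abs_of_nonneg hp2]; linarith
  · rw [abs_of_nonneg hp]; linarith
  · rw [abs_sub_comm, abs_of_nonneg (sub_nonneg.2 hmono)]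

/-- The coefficients in the estimate of the error term of the kernel. -/
def errorCoeff (t : ℕ → ℝ) (n L s : ℕ) : ℝ :=
  ∑ A ∈ Finset.range L, if s ≤ A then
    binCoeff n A * (2 * (2 ^ s * t (n % 2 ^ A + (2 ^ s - 1)))) else 0

/-- The coefficients in the estimate of the principal term of the kernel. -/
def principalCoeff (t : ℕ → ℝ) (n : ℕ) : ℕ → ℝ
  | 0 => ∑ l ∈ Finset.range (n % 2), t l
  | A + 1 => 4 * (|(binCoeff n A : ℝ) - binCoeff n (A + 1)| * ∑ l ∈ Finset.range (2 ^ A + 1), t l) +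
      (∑ l ∈ Finset.range (n % 2 ^ (A + 2)), t l - ∑ l ∈ Finset.range (n % 2 ^ (A + 1)), t l)

/-- The coefficients in the estimate of the kernel. -/
def kernelCoeff (t : ℕ → ℝ) (n s : ℕ) : ℝ :=
  errorCoeff t n (Nat.log 2 n + 1) s + principalCoeff t n s

theorem errorCoeff_nonneg (ht0 : ∀ k, 0 ≤ t k) (n L s : ℕ) : 0 ≤ errorCoeff t n L s := by
  refine Finset.sum_nonneg fun A _ => ?_
  have := ht0 (n % 2 ^ A + (2 ^ s - 1))
  split_ifs <;> positivity

theorem principalCoeff_nonneg (ht0 : ∀ k, 0 ≤ t k) (ht : Antitone t) (n s : ℕ) :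
    0 ≤ principalCoeff t n s := by
  cases s with
  | zero => exact Finset.sum_nonneg fun l _ => ht0 l
  | succ A => exact (abs_nonneg _).trans (abs_sub_principal_le ht0 ht n A)

theorem kernelCoeff_nonneg (ht0 : ∀ k, 0 ≤ t k) (ht : Antitone t) (n s : ℕ) :
    0 ≤ kernelCoeff t n s :=
  add_nonneg (errorCoeff_nonneg ht0 _ _ _) (principalCoeff_nonneg ht0 ht _ _)

/-- Abel summation moves the difference from the kernels to the coefficients; the upper boundary
term vanishes because digit `L` of `n` is zero. -/
theorem IsSign.abs_signPrincipal_le {r : ℕ → ℝ} (hr : IsSign r) (ht0 : ∀ k, 0 ≤ t k)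
    (ht : Antitone t) {n L : ℕ} (hn : n < 2 ^ L) :
    |signPrincipal r t n L| ≤
      ∑ A ∈ Finset.range (L + 1), principalCoeff t n A * signDyadic r A := by
  set a : ℕ → ℝ := fun A => binCoeff n A * (∑ l ∈ Finset.range (n % 2 ^ (A + 1)), t l) with ha
  have key : ∀ K, ∑ A ∈ Finset.range K, a A * (signDyadic r (A + 1) - signDyadic r A) =
      a K * signDyadic r K - a 0 * signDyadic r 0 +
        ∑ A ∈ Finset.range K, (a A - a (A + 1)) * signDyadic r (A + 1) := by
    intro K
    induction K with
    | zero => simp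
    | succ K ih => rw [Finset.sum_range_succ, ih, Finset.sum_range_succ]; ring
  have hL : a L = 0 := by simp [ha, binCoeff_of_lt hn]
  have ha0 : |a 0| ≤ principalCoeff t n 0 := by
    have h0 : 0 ≤ ∑ l ∈ Finset.range (n % 2), t l := Finset.sum_nonneg fun l _ => ht0 l
    simp only [ha, principalCoeff, zero_add, pow_one]
    rcases binCoeff_eq_zero_or_one n 0 with h | h
    · simpa [h] using h0
    · simp [h, abs_of_nonneg h0]
  have h1 : signPrincipal r t n L =
      ∑ A ∈ Finset.range L, a A * (signDyadic r (A + 1) - signDyadic r A) := rfl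
  rw [h1, key L, hL, zero_mul, zero_sub, Finset.sum_range_succ', add_comm]
  refine (abs_add_le _ _).trans (add_le_add ((Finset.abs_sum_le_sum_abs _ _).trans
    (Finset.sum_le_sum fun A _ => ?_)) ?_)
  · rw [abs_mul, abs_of_nonneg (hr.signDyadic_nonneg _)]
    exact mul_le_mul_of_nonneg_right (abs_sub_principal_le ht0 ht n A) (hr.signDyadic_nonneg _)
  · rw [abs_neg, abs_mul, abs_of_nonneg (hr.signDyadic_nonneg _)]
    exact mul_le_mul_of_nonneg_right ha0 (hr.signDyadic_nonneg _)

theorem sum_error_eq (t : ℕ → ℝ) (n L : ℕ) (g : ℕ → ℝ) :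
    ∑ A ∈ Finset.range L, binCoeff n A * ∑ s ∈ Finset.range (A + 1),
        2 * (2 ^ s * t (n % 2 ^ A + (2 ^ s - 1))) * g s =
      ∑ s ∈ Finset.range L, errorCoeff t n L s * g s := by
  simp only [errorCoeff, Finset.sum_mul, Finset.mul_sum]
  rw [Finset.sum_comm (s := Finset.range L) (t := Finset.range L)]
  refine Finset.sum_congr rfl fun A hA => ?_
  rw [← Finset.sum_subset (Finset.range_mono (show A + 1 ≤ L from Finset.mem_range.1 hA))]
  · refine Finset.sum_congr rfl fun s hs => ?_
    rw [if_pos (by have := Finset.mem_range.1 hs; omega)]; ring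
  · intro s _ hs
    rw [if_neg (by rw [Finset.mem_range] at hs; omega), zero_mul]

theorem IsSign.abs_signKernel_sub_le {r : ℕ → ℝ} (hr : IsSign r)
    (ht0 : ∀ k, 0 ≤ t k) (ht : Antitone t) {n L : ℕ} (hn : n < 2 ^ L) :
    |signKernel r t n - signWalsh r n * signPrincipal r t n L| ≤
      ∑ s ∈ Finset.range L, errorCoeff t n L s * signFejerMajorant r s := by
  rw [← sum_error_eq t n L (signFejerMajorant r)]
  exact hr.abs_signKernel_sub_signPrincipal ht0 ht hn

/-- The domination on which the convergence proof rests: error and principal part are put over the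
common majorants by `D_{2^s} ≤ G_s`. -/
theorem IsSign.abs_signKernel_le {r : ℕ → ℝ} (hr : IsSign r) (ht0 : ∀ k, 0 ≤ t k)
    (ht : Antitone t) (n : ℕ) :
    |signKernel r t n| ≤
      ∑ s ∈ Finset.range (Nat.log 2 n + 2), kernelCoeff t n s * signFejerMajorant r s := by
  have hn : n < 2 ^ (Nat.log 2 n + 1) := Nat.lt_pow_succ_log_self (by norm_num) n
  have h1 := hr.abs_signKernel_sub_le ht0 ht hn
  have h2 := hr.abs_signPrincipal_le ht0 ht hn
  have h3 : ∑ s ∈ Finset.range (Nat.log 2 n + 1), errorCoeff t n (Nat.log 2 n + 1) s *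
      signFejerMajorant r s ≤ ∑ s ∈ Finset.range (Nat.log 2 n + 2),
        errorCoeff t n (Nat.log 2 n + 1) s * signFejerMajorant r s :=
    Finset.sum_le_sum_of_subset_of_nonneg (Finset.range_mono (Nat.le_succ _)) fun s _ _ =>
      mul_nonneg (errorCoeff_nonneg ht0 _ _ _) (hr.signFejerMajorant_nonneg s)
  have h4 : ∑ s ∈ Finset.range (Nat.log 2 n + 2), principalCoeff t n s * signDyadic r s ≤
      ∑ s ∈ Finset.range (Nat.log 2 n + 2), principalCoeff t n s * signFejerMajorant r s :=
    Finset.sum_le_sum fun s _ => mul_le_mul_of_nonneg_left (hr.signDyadic_le_signFejerMajorant s)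
      (principalCoeff_nonneg ht0 ht n s)
  have h5 := abs_sub_abs_le_abs_sub (signKernel r t n)
    (signWalsh r n * signPrincipal r t n (Nat.log 2 n + 1))
  rw [abs_mul, hr.abs_signWalsh, one_mul] at h5
  simp only [kernelCoeff, add_mul, Finset.sum_add_distrib]
  linarith

theorem sum_block_le (ht0 : ∀ k, 0 ≤ t k) (ht : Antitone t) (n A : ℕ) :
    binCoeff n A * ∑ s ∈ Finset.range (A + 1), 2 * (2 ^ s * t (n % 2 ^ A + (2 ^ s - 1))) ≤
      4 * (∑ l ∈ Finset.range (n % 2 ^ (A + 1)), t l - ∑ l ∈ Finset.range (n % 2 ^ A), t l) := by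
  rw [mod_two_pow_succ_eq]
  rcases binCoeff_eq_zero_or_one n A with h | h
  · simp [h]
  · have := sum_two_pow_mul_le (t := fun j => t (n % 2 ^ A + j)) (fun k => ht0 _)
      (fun a b hab => ht (by omega)) A
    rw [h, mul_one, Finset.sum_range_add t, add_sub_cancel_left, Nat.cast_one, one_mul,
      ← Finset.mul_sum]
    linarith

/-- By dyadic condensation each digit one costs at most four times the weight on `[n % 2 ^ A, n % 2
^ (A + 1))`, and these blocks tile `[0, n)`. Hence no `υ` in the bound. -/
theorem sum_errorCoeff_le (ht0 : ∀ k, 0 ≤ t k) (ht : Antitone t) {n L : ℕ} (hn : n < 2 ^ L) :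
    ∑ s ∈ Finset.range L, errorCoeff t n L s ≤ 4 * ∑ l ∈ Finset.range n, t l := by
  have h := sum_error_eq t n L fun _ => 1
  simp only [mul_one] at h
  rw [← h]
  refine (Finset.sum_le_sum fun A _ => sum_block_le ht0 ht n A).trans ?_
  rw [← Finset.mul_sum, Finset.sum_range_sub (fun A => ∑ l ∈ Finset.range (n % 2 ^ A), t l),
    Nat.mod_eq_of_lt hn]
  simp [Nat.mod_one]

theorem sum_principalCoeff (t : ℕ → ℝ) {n L : ℕ} (hn : n < 2 ^ L) :
    ∑ s ∈ Finset.range (L + 1), principalCoeff t n s =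
      4 * (∑ A ∈ Finset.range L, |(binCoeff n A : ℝ) - binCoeff n (A + 1)| *
        ∑ l ∈ Finset.range (2 ^ A + 1), t l) + ∑ l ∈ Finset.range n, t l := by
  rw [Finset.sum_range_succ']
  simp only [principalCoeff]
  rw [Finset.sum_add_distrib, ← Finset.mul_sum,
    Finset.sum_range_sub (fun A => ∑ l ∈ Finset.range (n % 2 ^ (A + 1)), t l),
    Nat.mod_eq_of_lt (hn.trans_le (Nat.pow_le_pow_right (by norm_num) (Nat.le_succ L)))]
  simp only [zero_add, pow_one]
  ring

theorem sum_kernelCoeff_le (ht0 : ∀ k, 0 ≤ t k) (ht : Antitone t) {n : ℕ}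
    (h1 : ∑ l ∈ Finset.range (n + 1), t l = 1) :
    ∑ s ∈ Finset.range (Nat.log 2 n + 2), kernelCoeff t n s ≤
      5 + 4 * ∑ A ∈ Finset.range (Nat.log 2 n + 1), |(binCoeff n A : ℝ) - binCoeff n (A + 1)| *
        ∑ l ∈ Finset.range (2 ^ A + 1), t l := by
  have hn : n < 2 ^ (Nat.log 2 n + 1) := Nat.lt_pow_succ_log_self (by norm_num) n
  have h2 := sum_errorCoeff_le ht0 ht hn
  have h3 := sum_principalCoeff t hn
  have h4 := (sum_range_mono ht0 (Nat.le_succ n)).trans h1.le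
  have h5 : errorCoeff t n (Nat.log 2 n + 1) (Nat.log 2 n + 1) = 0 := by
    refine Finset.sum_eq_zero fun A hA => if_neg ?_
    have := Finset.mem_range.1 hA
    omega
  simp only [kernelCoeff, Finset.sum_add_distrib]
  rw [h3, Finset.sum_range_succ, h5]
  linarith

/-- Let `N` be the number of digits one. At the digit one preceded by exactly `j` lower ones, the
remainder `n % 2 ^ A` is at least `2 ^ j - 1`. -/
theorem exists_sum_binCoeff_mul_le (ht : Antitone t) {n L : ℕ}
    (hn : n < 2 ^ L) :
    ∃ N, 2 ^ N ≤ n + 1 ∧ ∑ A ∈ Finset.range L, binCoeff n A * t (n % 2 ^ A) ≤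
      ∑ j ∈ Finset.range N, t (2 ^ j - 1) := by
  induction L generalizing n with
  | zero => exact ⟨0, by simp, by simp⟩
  | succ A ih =>
    rw [Finset.sum_range_succ]
    rcases lt_or_ge n (2 ^ A) with h | h
    · simpa [binCoeff_of_lt h] using ih h
    · obtain ⟨m, hm, rfl⟩ := exists_two_pow_add h hn
      obtain ⟨N, hN, hs⟩ := ih hm
      refine ⟨N + 1, by rw [pow_succ]; omega, ?_⟩
      rw [Finset.sum_range_succ, binCoeff_two_pow_add hm, two_pow_add_mod le_rfl,
        Nat.mod_eq_of_lt hm, Nat.cast_one, one_mul]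
      refine add_le_add (le_trans (le_of_eq ?_) hs) (ht (by omega))
      refine Finset.sum_congr rfl fun B hB => ?_
      have := Finset.mem_range.1 hB
      rw [binCoeff_two_pow_add_of_lt this, two_pow_add_mod (by omega)]

/-- The first `J` terms are at most `t 0` each. The later ones decay geometrically, because `2 ^ j *
t (2 ^ j - 1)` is at most the total weight one. -/
theorem sum_binCoeff_mul_le (ht0 : ∀ k, 0 ≤ t k) (ht : Antitone t) {n L : ℕ}
    (hn : n < 2 ^ L) (h1 : ∑ l ∈ Finset.range (n + 1), t l = 1) (J : ℕ) :
    ∑ A ∈ Finset.range L, binCoeff n A * t (n % 2 ^ A) ≤ J * t 0 + 2 * (1 / 2) ^ J := by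
  obtain ⟨N, hN, hs⟩ := exists_sum_binCoeff_mul_le ht hn
  refine hs.trans ?_
  have hb : ∀ j < N, t (2 ^ j - 1) ≤ (1 / 2) ^ j := by
    intro j hj
    have h2 := mul_le_sum_range ht (2 ^ j)
    have h3 := sum_range_mono ht0
      ((Nat.pow_le_pow_right (by norm_num : 0 < 2) hj.le).trans hN)
    push_cast at h2
    rw [one_div, inv_pow, ← one_div, le_div_iff₀ (by positivity)]
    linarith
  -- The subtracted quantity is the unused part of the bound after `K` terms; keeping it makes every
  -- induction step linear.
  have h3 : ∀ K ≤ N, ∑ j ∈ Finset.range K, t (2 ^ j - 1) ≤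
      J * t 0 + 2 * (1 / 2) ^ J - if J ≤ K then 2 * (1 / 2) ^ K else (J - K) * t 0 + 2 * (1 / 2) ^ J := by
    intro K
    induction K with
    | zero =>
      intro _
      rcases Nat.eq_zero_or_pos J with rfl | hJ
      · simp
      · rw [if_neg (by omega)]
        simp
    | succ K ih =>
      intro hK
      rw [Finset.sum_range_succ]
      have h4 := ih (by omega)
      rcases lt_trichotomy (K + 1) J with h | h | h
      · rw [if_neg (by omega)] at h4 ⊢
        have := ht (Nat.zero_le (2 ^ K - 1))
        push_cast
        linarith
      · rw [if_neg (by omega)] at h4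
        rw [if_pos (by omega)]
        have := ht (Nat.zero_le (2 ^ K - 1))
        subst h
        push_cast at h4 ⊢
        linarith
      · rw [if_pos (by omega)] at h4 ⊢
        have := hb K (by omega)
        rw [pow_succ]
        linarith
  have h4 := h3 N le_rfl
  have h5 : 0 ≤ if J ≤ N then 2 * (1 / 2 : ℝ) ^ N else (J - N) * t 0 + 2 * (1 / 2) ^ J := by
    split_ifs with h
    · positivity
    · refine add_nonneg (mul_nonneg (sub_nonneg.2 ?_) (ht0 0)) (by positivity)
      exact_mod_cast (by omega : N ≤ J)
  linarith

theorem errorCoeff_le (ht0 : ∀ k, 0 ≤ t k) (ht : Antitone t) {n L : ℕ}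
    (hn : n < 2 ^ L) (h1 : ∑ l ∈ Finset.range (n + 1), t l = 1) (s J : ℕ) :
    errorCoeff t n L s ≤ 2 * 2 ^ s * (J * t 0 + 2 * (1 / 2) ^ J) := by
  refine le_trans ?_ (mul_le_mul_of_nonneg_left (sum_binCoeff_mul_le ht0 ht hn h1 J)
    (by positivity))
  rw [errorCoeff, Finset.mul_sum]
  refine Finset.sum_le_sum fun A _ => ?_
  have h2 : t (n % 2 ^ A + (2 ^ s - 1)) ≤ t (n % 2 ^ A) := ht (Nat.le_add_right _ _)
  have h3 := ht0 (n % 2 ^ A)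
  split_ifs
  · have : (binCoeff n A : ℝ) * (2 * (2 ^ s * t (n % 2 ^ A + (2 ^ s - 1)))) ≤
        binCoeff n A * (2 * (2 ^ s * t (n % 2 ^ A))) := by gcongr
    linarith
  · positivity

theorem principalCoeff_le (ht0 : ∀ k, 0 ≤ t k) (ht : Antitone t) (n s : ℕ) :
    principalCoeff t n s ≤ (8 * 2 ^ s) * t 0 := by
  have h0 := ht0 0
  have hT : ∀ k : ℕ, ∀ K : ℕ, k ≤ K → ∑ l ∈ Finset.range k, t l ≤ K * t 0 := fun k K h =>
    (sum_range_mono ht0 h).trans (sum_range_le_mul ht K)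
  cases s with
  | zero =>
    have := hT (n % 2) 8 (by omega)
    simpa [principalCoeff] using this
  | succ A =>
    rw [principalCoeff]
    have h1 := hT (n % 2 ^ (A + 2)) (4 * 2 ^ A)
      ((Nat.mod_lt _ (by positivity)).le.trans (by rw [pow_succ, pow_succ]; omega))
    have h2 : 0 ≤ ∑ l ∈ Finset.range (n % 2 ^ (A + 1)), t l := Finset.sum_nonneg fun l _ => ht0 l
    have h3 := hT (2 ^ A + 1) (2 * 2 ^ A) (by have : 0 < 2 ^ A := by positivity
                                              omega)
    have h4 : |(binCoeff n A : ℝ) - binCoeff n (A + 1)| ≤ 1 := by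
      rcases binCoeff_eq_zero_or_one n A with ha | ha <;>
        rcases binCoeff_eq_zero_or_one n (A + 1) with hb | hb <;> simp [ha, hb]
    have h5 : 0 ≤ ∑ l ∈ Finset.range (2 ^ A + 1), t l := Finset.sum_nonneg fun l _ => ht0 l
    have h6 := mul_le_mul_of_nonneg_right h4 h5
    push_cast at h1 h3
    rw [pow_succ (2 : ℝ) A]
    linarith

/-- For fixed `s` the cut-off `J` is chosen first to make the geometric remainder small; then `t_0`
is taken small depending on `J`. -/
theorem tendsto_kernelCoeff {ι : Type*} {l : Filter ι} {t : ι → ℕ → ℝ} (ht0 : ∀ a k, 0 ≤ t a k)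
    (ht : ∀ a, Antitone (t a)) {n : ι → ℕ}
    (h1 : ∀ a, ∑ l ∈ Finset.range (n a + 1), t a l = 1)
    (hlim : Tendsto (fun a => t a 0) l (𝓝 0)) (s : ℕ) :
    Tendsto (fun a => kernelCoeff (t a) (n a) s) l (𝓝 0) := by
  have hb : ∀ (a : ι) (J : ℕ), kernelCoeff (t a) (n a) s ≤
      (2 * 2 ^ s * J + 8 * 2 ^ s) * t a 0 + 4 * 2 ^ s * (1 / 2) ^ J := by
    intro a J
    have h2 := errorCoeff_le (ht0 a) (ht a) (Nat.lt_pow_succ_log_self (by norm_num) (n a)) (h1 a) s J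
    have h3 := principalCoeff_le (ht0 a) (ht a) (n a) s
    rw [kernelCoeff]
    linarith
  rw [tendsto_order]
  refine ⟨fun b hb0 => Eventually.of_forall fun a =>
    hb0.trans_le (kernelCoeff_nonneg (ht0 a) (ht a) _ _), fun b hb0 => ?_⟩
  have h2 : Tendsto (fun J : ℕ => 4 * 2 ^ s * (1 / 2 : ℝ) ^ J) atTop (𝓝 (4 * 2 ^ s * 0)) :=
    (tendsto_pow_atTop_nhds_zero_of_lt_one (by norm_num) (by norm_num)).const_mul _
  rw [mul_zero] at h2
  obtain ⟨J, hJ⟩ := ((tendsto_order.1 h2).2 (b / 2) (by linarith)).exists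
  have h3 : Tendsto (fun a => (2 * 2 ^ s * J + 8 * 2 ^ s) * t a 0) l
      (𝓝 ((2 * 2 ^ s * J + 8 * 2 ^ s) * 0)) := hlim.const_mul _
  rw [mul_zero] at h3
  filter_upwards [(tendsto_order.1 h3).2 (b / 2) (by linarith)] with a ha
  linarith [hb a J]

end Weights

/-! ### Dyadic digits of real numbers, dyadic sums and intervals. -/

section Digits

theorem digit_eq_zero_or_one (x : ℝ) (k : ℕ) : digit x k = 0 ∨ digit x k = 1 := by
  unfold digit; omega

theorem floor_two_pow_succ_mul {x : ℝ} (k : ℕ) :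
    ⌊(2 : ℝ) ^ (k + 1) * x⌋₊ = 2 * ⌊(2 : ℝ) ^ k * x⌋₊ + digit x k := by
  have h : ⌊(2 : ℝ) ^ (k + 1) * x⌋₊ / 2 = ⌊(2 : ℝ) ^ k * x⌋₊ := by
    rw [← Nat.floor_div_natCast]
    congr 1
    rw [pow_succ]; push_cast; ring
  rw [digit]
  omega

theorem floor_eq_of_digit_eq {x y : ℝ} {L k : ℕ} (hk : L ≤ k)
    (h0 : ⌊(2 : ℝ) ^ L * x⌋₊ = ⌊(2 : ℝ) ^ L * y⌋₊)
    (h : ∀ j, L ≤ j → j < k → digit x j = digit y j) :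
    ⌊(2 : ℝ) ^ k * x⌋₊ = ⌊(2 : ℝ) ^ k * y⌋₊ := by
  induction k, hk using Nat.le_induction with
  | base => exact h0
  | succ k hk ih =>
    rw [floor_two_pow_succ_mul, floor_two_pow_succ_mul, h k hk (Nat.lt_succ_self k),
      ih fun j hj hjk => h j hj (by omega)]

theorem floor_eq_iff_digit_eq {x y : ℝ} (hx : x ∈ unitI) (hy : y ∈ unitI) (n : ℕ) :
    ⌊(2 : ℝ) ^ n * x⌋₊ = ⌊(2 : ℝ) ^ n * y⌋₊ ↔ ∀ k < n, digit x k = digit y k := by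
  refine ⟨fun h => ?_, fun h => ?_⟩
  · induction n with
    | zero => simp
    | succ n ih =>
      rw [floor_two_pow_succ_mul, floor_two_pow_succ_mul] at h
      have h1 := digit_eq_zero_or_one x n
      have h2 := digit_eq_zero_or_one y n
      intro k hk
      rcases Nat.lt_succ_iff_lt_or_eq.1 hk with hk | rfl
      · exact ih (by omega) k hk
      · omega
  · refine floor_eq_of_digit_eq (Nat.zero_le n) ?_ fun j _ hj => h j hj
    rw [pow_zero, one_mul, one_mul, Nat.floor_eq_zero.2 hx.2, Nat.floor_eq_zero.2 hy.2]

theorem eq_of_floor_eq {x y : ℝ} (hx : x ∈ unitI) (hy : y ∈ unitI) {L : ℕ}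
    (h : ∀ k, L ≤ k → ⌊(2 : ℝ) ^ k * x⌋₊ = ⌊(2 : ℝ) ^ k * y⌋₊) : x = y := by
  by_contra hne
  have hpos : 0 < |x - y| := abs_pos.2 (sub_ne_zero.2 hne)
  obtain ⟨m, hm⟩ := pow_unbounded_of_one_lt (1 / |x - y|) (by norm_num : (1 : ℝ) < 2)
  rw [div_lt_iff₀ hpos] at hm
  have h2 : (2 : ℝ) ^ m ≤ 2 ^ max L m := pow_le_pow_right₀ (by norm_num) (le_max_right _ _)
  have h1 := h (max L m) (le_max_left _ _)
  set K := max L m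
  have hxp : 0 ≤ (2 : ℝ) ^ K * x := mul_nonneg (by positivity) hx.1
  have hyp : 0 ≤ (2 : ℝ) ^ K * y := mul_nonneg (by positivity) hy.1
  have a1 := Nat.floor_le hxp
  have a2 := Nat.lt_floor_add_one ((2 : ℝ) ^ K * x)
  have a3 := Nat.floor_le hyp
  have a4 := Nat.lt_floor_add_one ((2 : ℝ) ^ K * y)
  rw [h1] at a1 a2
  have h3 : (2 : ℝ) ^ K * |x - y| < 1 := by
    rw [← abs_of_pos (show (0 : ℝ) < 2 ^ K by positivity), ← abs_mul, abs_lt, mul_sub]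
    constructor <;> linarith
  nlinarith

/-- The digits of the terminating expansion are not eventually `1`. -/
theorem exists_digit_eq_zero {x : ℝ} (hx : x ∈ unitI) (L : ℕ) : ∃ k, L ≤ k ∧ digit x k = 0 := by
  by_contra! h
  have h1 : ∀ k, L ≤ k → digit x k = 1 := fun k hk =>
    (digit_eq_zero_or_one x k).resolve_left (h k hk)
  have h2 : ∀ m, 1 - ((2 : ℝ) ^ (L + m) * x - ⌊(2 : ℝ) ^ (L + m) * x⌋₊) =
      2 ^ m * (1 - ((2 : ℝ) ^ L * x - ⌊(2 : ℝ) ^ L * x⌋₊)) := by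
    intro m
    induction m with
    | zero => simp
    | succ m ih =>
      rw [← add_assoc, floor_two_pow_succ_mul, h1 (L + m) (by omega), pow_succ 2 m]
      push_cast
      rw [pow_succ]
      linear_combination 2 * ih
  have h3 : 0 < 1 - ((2 : ℝ) ^ L * x - ⌊(2 : ℝ) ^ L * x⌋₊) := by
    linarith [Nat.lt_floor_add_one ((2 : ℝ) ^ L * x)]
  obtain ⟨m, hm⟩ := pow_unbounded_of_one_lt
    (1 / (1 - ((2 : ℝ) ^ L * x - ⌊(2 : ℝ) ^ L * x⌋₊))) (by norm_num : (1 : ℝ) < 2)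
  rw [div_lt_iff₀ h3, ← h2] at hm
  have := Nat.floor_le (mul_nonneg (by positivity) hx.1 : 0 ≤ (2 : ℝ) ^ (L + m) * x)
  linarith

theorem hasSum_geometric_two_succ : HasSum (fun k : ℕ => (1 : ℝ) / 2 ^ (k + 1)) 1 := by
  have h := hasSum_geometric_two' 1
  have e : (fun k : ℕ => (1 : ℝ) / 2 ^ (k + 1)) = fun k => 1 / 2 / 2 ^ k := by
    funext k
    rw [div_div, pow_succ']
  rwa [e]

theorem tsum_digits_lt_one {c : ℕ → ℕ} (hc : ∀ k, c k = 0 ∨ c k = 1) {K : ℕ} (hK : c K = 0) :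
    Summable (fun k => (c k : ℝ) / 2 ^ (k + 1)) ∧ ∑' k, (c k : ℝ) / 2 ^ (k + 1) < 1 := by
  have hle : ∀ k, (c k : ℝ) / 2 ^ (k + 1) ≤ 1 / 2 ^ (k + 1) := by
    intro k
    gcongr
    rcases hc k with h | h <;> simp [h]
  have hs : Summable (fun k => (c k : ℝ) / 2 ^ (k + 1)) :=
    Summable.of_nonneg_of_le (fun k => by positivity) hle hasSum_geometric_two_succ.summable
  refine ⟨hs, ?_⟩
  rw [← hasSum_geometric_two_succ.tsum_eq]
  exact hs.tsum_lt_tsum hle (i := K) (by rw [hK]; simp) hasSum_geometric_two_succ.summable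

theorem summable_digits {c : ℕ → ℕ} (hc : ∀ k, c k = 0 ∨ c k = 1) :
    Summable (fun k => (c k : ℝ) / 2 ^ (k + 1)) := by
  refine Summable.of_nonneg_of_le (fun k => by positivity) (fun k => ?_)
    hasSum_geometric_two_succ.summable
  gcongr
  rcases hc k with h | h <;> simp [h]

/-- Infinitely many zero digits keep the rescaled tail strictly below one, so the floor reads off
the leading digits. -/
theorem digit_tsum {c : ℕ → ℕ} (hc : ∀ k, c k = 0 ∨ c k = 1) (hinf : ∀ L, ∃ k, L ≤ k ∧ c k = 0)
    (k : ℕ) : digit (∑' j, (c j : ℝ) / 2 ^ (j + 1)) k = c k := by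
  have hs := summable_digits hc
  have hN : ∀ m, ∃ N : ℕ, (2 : ℝ) ^ m * ∑ j ∈ Finset.range m, (c j : ℝ) / 2 ^ (j + 1) = N := by
    intro m
    induction m with
    | zero => exact ⟨0, by simp⟩
    | succ m ih =>
      obtain ⟨N, hN⟩ := ih
      refine ⟨2 * N + c m, ?_⟩
      rw [Finset.sum_range_succ, mul_add, pow_succ, mul_right_comm, hN]
      push_cast
      field_simp
  obtain ⟨N, hN⟩ := hN k
  obtain ⟨K, hK, hK0⟩ := hinf (k + 1)
  obtain ⟨h1, h2⟩ := tsum_digits_lt_one (c := fun j => c (j + (k + 1))) (fun j => hc _)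
    (K := K - (k + 1)) (by rw [Nat.sub_add_cancel hK]; exact hK0)
  have h3 : 0 ≤ ∑' j, (c (j + (k + 1)) : ℝ) / 2 ^ (j + 1) := tsum_nonneg fun j => by positivity
  have h4 : (2 : ℝ) ^ (k + 1) * ∑' j, (c j : ℝ) / 2 ^ (j + 1) =
      ((2 * N + c k : ℕ) : ℝ) + ∑' j, (c (j + (k + 1)) : ℝ) / 2 ^ (j + 1) := by
    rw [← hs.sum_add_tsum_nat_add (k + 1), mul_add, Finset.sum_range_succ, mul_add, pow_succ,
      mul_right_comm, hN, ← tsum_mul_left]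
    push_cast
    congr 1
    · field_simp
    · refine tsum_congr fun j => ?_
      rw [show j + (k + 1) + 1 = k + 1 + (j + 1) by ring, pow_add 2 (k + 1) (j + 1), pow_succ 2 k]
      field_simp
  have h5 : ⌊(2 : ℝ) ^ (k + 1) * ∑' j, (c j : ℝ) / 2 ^ (j + 1)⌋₊ = 2 * N + c k := by
    rw [h4, Nat.floor_eq_iff (by positivity)]
    constructor <;> linarith
  rw [digit, h5]
  have := hc k
  omega

theorem tsum_digits_mem_unitI {c : ℕ → ℕ} (hc : ∀ k, c k = 0 ∨ c k = 1)
    (hinf : ∀ L, ∃ k, L ≤ k ∧ c k = 0) : ∑' j, (c j : ℝ) / 2 ^ (j + 1) ∈ unitI := by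
  obtain ⟨K, -, hK⟩ := hinf 0
  exact ⟨tsum_nonneg fun j => by positivity, (tsum_digits_lt_one hc hK).2⟩

theorem dyadicAdd_eq (x y : ℝ) : dyadicAdd x y =
    ∑' k, ((if digit x k = digit y k then 0 else 1 : ℕ) : ℝ) / 2 ^ (k + 1) := by
  refine tsum_congr fun k => ?_
  rcases digit_eq_zero_or_one x k with h | h <;> rcases digit_eq_zero_or_one y k with h' | h' <;>
    simp [h, h']

/-- Agreement of the digits at infinitely many places says exactly that the digit differences are
not eventually one; otherwise their sum would be re-expanded with other digits. -/
theorem digit_dyadicAdd {x y : ℝ} (h : ∀ L, ∃ k, L ≤ k ∧ digit x k = digit y k) (k : ℕ) :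
    digit (dyadicAdd x y) k = if digit x k = digit y k then 0 else 1 := by
  rw [dyadicAdd_eq]
  refine digit_tsum (c := fun k => if digit x k = digit y k then 0 else 1) (fun k => ?_)
    (fun L => ?_) k
  · split_ifs <;> simp
  · obtain ⟨k, hk, hk2⟩ := h L
    exact ⟨k, hk, if_pos hk2⟩

theorem dyadicAdd_mem_unitI {x y : ℝ} (h : ∀ L, ∃ k, L ≤ k ∧ digit x k = digit y k) :
    dyadicAdd x y ∈ unitI := by
  rw [dyadicAdd_eq]
  refine tsum_digits_mem_unitI (c := fun k => if digit x k = digit y k then 0 else 1) (fun k => ?_)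
    (fun L => ?_)
  · split_ifs <;> simp
  · obtain ⟨k, hk, hk2⟩ := h L
    exact ⟨k, hk, if_pos hk2⟩

theorem rademacher_eq_one_or (k : ℕ) (x : ℝ) : rademacher k x = 1 ∨ rademacher k x = -1 := by
  rcases digit_eq_zero_or_one x k with h | h <;> simp [rademacher, h]

theorem rademacher_eq_iff {k : ℕ} {x y : ℝ} :
    rademacher k x = rademacher k y ↔ digit x k = digit y k := by
  rcases digit_eq_zero_or_one x k with h | h <;> rcases digit_eq_zero_or_one y k with h' | h' <;>
    norm_num [rademacher, h, h']

theorem rademacher_dyadicAdd {x y : ℝ} (h : ∀ L, ∃ k, L ≤ k ∧ digit x k = digit y k) (k : ℕ) :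
    rademacher k (dyadicAdd x y) = rademacher k x * rademacher k y := by
  rw [rademacher, digit_dyadicAdd h]
  rcases digit_eq_zero_or_one x k with h | h <;> rcases digit_eq_zero_or_one y k with h' | h' <;>
    norm_num [rademacher, h, h']

theorem digit_one_div_two_pow (i k : ℕ) :
    digit (1 / 2 ^ (i + 1)) k = if k = i then 1 else 0 := by
  rcases lt_trichotomy k i with h | rfl | h
  · rw [if_neg h.ne, digit, Nat.floor_eq_zero.2]
    rw [mul_one_div, div_lt_one (by positivity)]
    exact pow_lt_pow_right₀ (by norm_num) (by omega)
  · rw [if_pos rfl, digit, mul_one_div_cancel (by positivity)]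
    simp
  · obtain ⟨c, rfl⟩ := Nat.exists_eq_add_of_lt h
    have : (2 : ℝ) ^ (i + c + 1 + 1) * (1 / 2 ^ (i + 1)) = ((2 * 2 ^ c : ℕ) : ℝ) := by
      push_cast; field_simp; ring
    rw [if_neg (by omega), digit, this, Nat.floor_natCast]
    omega

theorem exists_digit_eq_one_div {x : ℝ} (hx : x ∈ unitI) (i L : ℕ) :
    ∃ k, L ≤ k ∧ digit x k = digit (1 / 2 ^ (i + 1)) k := by
  obtain ⟨k, hk, h⟩ := exists_digit_eq_zero hx (max L (i + 1))
  refine ⟨k, (le_max_left _ _).trans hk, ?_⟩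
  have := (le_max_right L (i + 1)).trans hk
  rw [h, digit_one_div_two_pow, if_neg (by omega)]

theorem mem_dyadicInterval_iff_floor {n : ℕ} {x y : ℝ} :
    y ∈ dyadicInterval n x ↔ ⌊(2 : ℝ) ^ n * y⌋ = ⌊(2 : ℝ) ^ n * x⌋ := by
  rw [dyadicInterval, Set.mem_Ico, Int.floor_eq_iff, div_le_iff₀ (by positivity),
    lt_div_iff₀ (by positivity), mul_comm y]

theorem dyadicInterval_subset_unitI {n : ℕ} {x : ℝ} (hx : x ∈ unitI) :
    dyadicInterval n x ⊆ unitI := by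
  intro y hy
  rw [mem_dyadicInterval_iff_floor] at hy
  have hp : (0 : ℝ) < 2 ^ n := by positivity
  have h0 : (0 : ℤ) ≤ ⌊(2 : ℝ) ^ n * x⌋ := Int.floor_nonneg.2 (mul_nonneg hp.le hx.1)
  have h1 : ⌊(2 : ℝ) ^ n * x⌋ < 2 ^ n := by
    rw [Int.floor_lt]
    push_cast
    nlinarith [hx.2]
  rw [← hy] at h0 h1
  rw [Int.floor_nonneg] at h0
  rw [Int.floor_lt] at h1
  push_cast at h1
  exact ⟨nonneg_of_mul_nonneg_right h0 hp, by nlinarith⟩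

theorem mem_dyadicInterval_iff {n : ℕ} {x y : ℝ} (hx : x ∈ unitI) (hy : y ∈ unitI) :
    y ∈ dyadicInterval n x ↔ ∀ k < n, rademacher k y = rademacher k x := by
  have hp : (0 : ℝ) ≤ 2 ^ n := by positivity
  simp only [rademacher_eq_iff]
  rw [mem_dyadicInterval_iff_floor, ← floor_eq_iff_digit_eq hy hx,
    ← Int.natCast_floor_eq_floor (mul_nonneg hp hx.1),
    ← Int.natCast_floor_eq_floor (mul_nonneg hp hy.1), Nat.cast_inj]

/-- Such a `u` has the digits complementary to those of `x` from place `L` on, so the integer part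
of `2 ^ L * u` determines it. -/
theorem countable_setOf_digit_ne (x : ℝ) (L : ℕ) :
    {u | u ∈ unitI ∧ ∀ k, L ≤ k → digit x k ≠ digit u k}.Countable := by
  refine Set.countable_of_injective_of_countable_image (f := fun u : ℝ => ⌊(2 : ℝ) ^ L * u⌋₊) ?_
    (Set.to_countable _)
  rintro u ⟨hu, hu'⟩ v ⟨hv, hv'⟩ h
  refine eq_of_floor_eq hu hv fun k hk => floor_eq_of_digit_eq hk h fun j hj _ => ?_
  have h1 := hu' j hj
  have h2 := hv' j hj
  have := digit_eq_zero_or_one x j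
  have := digit_eq_zero_or_one u j
  have := digit_eq_zero_or_one v j
  omega

theorem ae_exists_digit_eq (x : ℝ) :
    ∀ᵐ u ∂μI, u ∈ unitI ∧ ∀ L, ∃ k, L ≤ k ∧ digit x k = digit u k := by
  have h1 : ∀ᵐ u ∂μI, u ∈ unitI := ae_restrict_mem measurableSet_Ico
  have h2 : ∀ᵐ u ∂(volume : Measure ℝ),
      u ∉ ⋃ L, {u | u ∈ unitI ∧ ∀ k, L ≤ k → digit x k ≠ digit u k} :=
    (Set.countable_iUnion fun L => countable_setOf_digit_ne x L).ae_notMem _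
  filter_upwards [h1, ae_restrict_of_ae h2] with u hu hu2
  refine ⟨hu, fun L => ?_⟩
  by_contra! h
  exact hu2 (Set.mem_iUnion.2 ⟨L, hu, h⟩)

end Digits

/-! ### Integrals of the kernels and the interval form of the majorants. -/

section Kernels

instance isProbabilityMeasure_μI : IsProbabilityMeasure μI := ⟨by simp [μI, unitI]⟩

theorem measurable_digit (k : ℕ) : Measurable fun u => digit u k := by
  unfold digit
  exact (measurable_from_nat (f := fun m : ℕ => m % 2)).comp
    (Nat.measurable_floor.comp (measurable_id.const_mul _))

theorem measurable_rademacher (k : ℕ) : Measurable (rademacher k) := by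
  unfold rademacher
  exact (measurable_from_nat (f := fun m : ℕ => (-1 : ℝ) ^ m)).comp (measurable_digit k)

/-- The values of the Rademacher functions at the dyadic sum of `x` and `u`, for almost every
`u`. -/
def relSign (x u : ℝ) (k : ℕ) : ℝ := rademacher k x * rademacher k u

theorem isSign_rademacher (x : ℝ) : IsSign fun k => rademacher k x := fun k =>
  rademacher_eq_one_or k x

theorem isSign_relSign (x u : ℝ) : IsSign (relSign x u) := fun k => by
  unfold relSign
  rcases rademacher_eq_one_or k x with h | h <;>
    rcases rademacher_eq_one_or k u with h' | h' <;> simp [h, h']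

theorem rademacher_zero (k : ℕ) : rademacher k 0 = 1 := by simp [rademacher, digit]

theorem relSign_zero (u : ℝ) : relSign 0 u = fun k => rademacher k u := by
  funext k; simp [relSign, rademacher_zero]

theorem walsh_eq (n : ℕ) (x : ℝ) : walsh n x = signWalsh (fun k => rademacher k x) n := rfl

theorem meanKernel_eq (t : ℕ → ℕ → ℝ) (n : ℕ) (x : ℝ) :
    meanKernel t n x = signKernel (fun k => rademacher k x) (fun k => t k n) n := by
  rw [meanKernel, signKernel, Finset.range_eq_Ico, Finset.sum_eq_sum_Ico_succ_bot (by omega),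
    signDirichlet_zero, mul_zero, zero_add]
  rfl

theorem ae_rademacher_dyadicAdd (x : ℝ) :
    ∀ᵐ u ∂μI, (fun k => rademacher k (dyadicAdd x u)) = relSign x u := by
  filter_upwards [ae_exists_digit_eq x] with u hu
  funext k
  exact rademacher_dyadicAdd hu.2 k

theorem measurable_relSign (x : ℝ) (k : ℕ) : Measurable fun u => relSign x u k :=
  (measurable_rademacher k).const_mul _

theorem measurable_signWalsh_relSign (x : ℝ) (n : ℕ) :
    Measurable fun u => signWalsh (relSign x u) n :=
  Finset.measurable_fun_prod _ fun k _ => (measurable_relSign x k).pow_const _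

theorem measurable_signDirichlet_relSign (x : ℝ) (n : ℕ) :
    Measurable fun u => signDirichlet (relSign x u) n :=
  Finset.measurable_fun_sum _ fun k _ => measurable_signWalsh_relSign x k

theorem measurable_signKernel_relSign (x : ℝ) (t : ℕ → ℝ) (n : ℕ) :
    Measurable fun u => signKernel (relSign x u) t n :=
  Finset.measurable_fun_sum _ fun k _ => (measurable_signDirichlet_relSign x k).const_mul _

theorem IsSign.abs_signDirichlet_le {r : ℕ → ℝ} (hr : IsSign r) (n : ℕ) :
    |signDirichlet r n| ≤ n := by
  refine (Finset.abs_sum_le_sum_abs _ _).trans ?_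
  simp [hr.abs_signWalsh]

theorem IsSign.abs_signKernel_le_const {r : ℕ → ℝ} (hr : IsSign r) (t : ℕ → ℝ) (n : ℕ) :
    |signKernel r t n| ≤ ∑ k ∈ Finset.range (n + 1), |t (n - k)| * k := by
  refine (Finset.abs_sum_le_sum_abs _ _).trans (Finset.sum_le_sum fun k _ => ?_)
  rw [abs_mul]
  exact mul_le_mul_of_nonneg_left (hr.abs_signDirichlet_le k) (abs_nonneg _)

theorem integrable_signWalsh_relSign (x : ℝ) (n : ℕ) :
    Integrable (fun u => signWalsh (relSign x u) n) μI :=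
  Integrable.of_bound (measurable_signWalsh_relSign x n).aestronglyMeasurable 1
    (Eventually.of_forall fun u => ((isSign_relSign x u).abs_signWalsh n).le)

theorem integrable_signKernel_relSign (x : ℝ) (t : ℕ → ℝ) (n : ℕ) :
    Integrable (fun u => signKernel (relSign x u) t n) μI :=
  Integrable.of_bound (measurable_signKernel_relSign x t n).aestronglyMeasurable _
    (Eventually.of_forall fun u => (isSign_relSign x u).abs_signKernel_le_const t n)

theorem signWalsh_div_two (r : ℕ → ℝ) (j : ℕ) :
    signWalsh r j = signWalsh (fun k => r (k + 1)) (j / 2) * r 0 ^ (j % 2) := by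
  have h : j < 2 ^ (Nat.log 2 j + 1) := Nat.lt_pow_succ_log_self (by norm_num) j
  rw [signWalsh_eq_prod r (L := Nat.log 2 j + 1 + 1) (h.trans_le
      (Nat.pow_le_pow_right (by norm_num) (Nat.le_succ _))),
    signWalsh_eq_prod _ (L := Nat.log 2 j + 1) ((Nat.div_le_self _ _).trans_lt h),
    Finset.prod_range_succ']
  congr 1
  · refine Finset.prod_congr rfl fun k _ => ?_
    rw [binCoeff, binCoeff, Nat.div_div_eq_div_mul, pow_succ']
  · simp [binCoeff]

theorem integral_unitI_eq (g : ℝ → ℝ) : ∫ u, g u ∂μI = ∫ u in (0 : ℝ)..1, g u := by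
  rw [μI, unitI, intervalIntegral.integral_of_le zero_le_one, integral_Ico_eq_integral_Ioo,
    integral_Ioc_eq_integral_Ioo]

theorem integral_unitI_split {g : ℝ → ℝ} (hg : Integrable g μI) :
    ∫ u, g u ∂μI = 1 / 2 * ∫ v, g (v / 2) ∂μI + 1 / 2 * ∫ v, g (v / 2 + 1 / 2) ∂μI := by
  have hi : IntervalIntegrable g volume 0 1 := by
    rw [intervalIntegrable_iff_integrableOn_Ico_of_le zero_le_one]; exact hg
  have h1 := intervalIntegral.integral_comp_div (a := 0) (b := 1) g (two_ne_zero' ℝ)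
  have h2 := intervalIntegral.integral_comp_div_add (a := 0) (b := 1) g (two_ne_zero' ℝ) (1 / 2)
  rw [integral_unitI_eq, integral_unitI_eq, integral_unitI_eq, h1, h2]
  have e : (1 : ℝ) / 2 + 1 / 2 = 1 := by norm_num
  rw [zero_div, zero_add, e, ← intervalIntegral.integral_add_adjacent_intervals
    (hi.mono_set (c := 0) (d := 1 / 2) ?_) (hi.mono_set (c := 1 / 2) (d := 1) ?_)]
  · simp only [smul_eq_mul]; ring
  · rw [Set.uIcc_of_le (by norm_num), Set.uIcc_of_le (by norm_num)]
    exact Set.Icc_subset_Icc le_rfl (by norm_num)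
  · rw [Set.uIcc_of_le (by norm_num), Set.uIcc_of_le (by norm_num)]
    exact Set.Icc_subset_Icc (by norm_num) le_rfl

theorem digit_half_succ (v : ℝ) (k : ℕ) : digit (v / 2) (k + 1) = digit v k := by
  rw [digit, digit, pow_succ]
  congr 2
  ring

theorem digit_half_add_half_succ {v : ℝ} (hv : v ∈ unitI) (k : ℕ) :
    digit (v / 2 + 1 / 2) (k + 1) = digit v k := by
  have e : (2 : ℝ) ^ (k + 1 + 1) * (v / 2 + 1 / 2) =
      2 ^ (k + 1) * v + ((2 * 2 ^ k : ℕ) : ℝ) := by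
    push_cast; ring
  have := hv.1
  rw [digit, digit, e, Nat.floor_add_natCast (by positivity)]
  omega

theorem digit_half_zero {v : ℝ} (hv : v ∈ unitI) : digit (v / 2) 0 = 0 := by
  have e : (2 : ℝ) ^ (0 + 1) * (v / 2) = v := by ring
  rw [digit, e, Nat.floor_eq_zero.2 hv.2]

theorem digit_half_add_half_zero {v : ℝ} (hv : v ∈ unitI) : digit (v / 2 + 1 / 2) 0 = 1 := by
  have e : (2 : ℝ) ^ (0 + 1) * (v / 2 + 1 / 2) = v + (1 : ℕ) := by push_cast; ring
  rw [digit, e, Nat.floor_add_natCast hv.1, Nat.floor_eq_zero.2 hv.2]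

/-- On each half of the interval, rescaled, `w_j` is `w_{j/2}` up to sign. For odd `j` the signs are
opposite and the halves cancel; for even `j` the claim descends to `j / 2`. -/
theorem integral_walsh {j : ℕ} (hj : j ≠ 0) : ∫ u, walsh j u ∂μI = 0 := by
  induction j using Nat.strong_induction_on with
  | _ j ih =>
    have hi : Integrable (walsh j) μI := by
      have := integrable_signWalsh_relSign 0 j
      simp only [relSign_zero] at this
      exact this
    have h1 : ∫ v, walsh j (v / 2) ∂μI = ∫ v, walsh (j / 2) v ∂μI := by
      refine setIntegral_congr_fun measurableSet_Ico fun v hv => ?_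
      simp only [walsh_eq]
      rw [signWalsh_div_two]
      simp only [rademacher, digit_half_succ, digit_half_zero hv, pow_zero, one_pow, mul_one]
    have h2 : ∫ v, walsh j (v / 2 + 1 / 2) ∂μI =
        ∫ v, walsh (j / 2) v * (-1) ^ (j % 2) ∂μI := by
      refine setIntegral_congr_fun measurableSet_Ico fun v hv => ?_
      simp only [walsh_eq]
      rw [signWalsh_div_two]
      simp only [rademacher, digit_half_add_half_succ hv, digit_half_add_half_zero hv, pow_one]
    rw [integral_unitI_split hi, h1, h2, integral_mul_const]
    rcases Nat.mod_two_eq_zero_or_one j with h | h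
    · rw [ih (j / 2) (by omega) (by omega)]; simp
    · rw [h]; ring

theorem signWalsh_relSign (x u : ℝ) (n : ℕ) :
    signWalsh (relSign x u) n = walsh n x * walsh n u := by
  simp only [signWalsh, relSign, walsh, mul_pow, Finset.prod_mul_distrib]

theorem integral_signDirichlet_relSign (x : ℝ) {k : ℕ} (hk : k ≠ 0) :
    ∫ u, signDirichlet (relSign x u) k ∂μI = 1 := by
  unfold signDirichlet
  rw [integral_finsetSum _ fun j _ => integrable_signWalsh_relSign x j,
    Finset.sum_eq_single_of_mem 0 (Finset.mem_range.2 (Nat.pos_of_ne_zero hk))]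
  · simp [signWalsh_zero]
  · intro j _ hj
    simp only [signWalsh_relSign]
    rw [integral_const_mul, integral_walsh hj, mul_zero]

theorem integral_signKernel_relSign (x : ℝ) (t : ℕ → ℝ) (n : ℕ) :
    ∫ u, signKernel (relSign x u) t n ∂μI = ∑ l ∈ Finset.range n, t l := by
  unfold signKernel
  have hi : ∀ k, Integrable (fun u => signDirichlet (relSign x u) k) μI := fun k =>
    integrable_finsetSum _ fun j _ => integrable_signWalsh_relSign x j
  rw [integral_finsetSum _ fun k _ => (hi k).const_mul _, Finset.sum_range_succ']
  simp only [signDirichlet_zero, mul_zero, integral_zero, add_zero]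
  rw [← Finset.sum_range_reflect t n]
  refine Finset.sum_congr rfl fun k _ => ?_
  rw [integral_const_mul, integral_signDirichlet_relSign x (Nat.succ_ne_zero k), mul_one]
  congr 1
  omega

theorem signDyadic_eq_ite {r : ℕ → ℝ} (hr : IsSign r) (s : ℕ) :
    signDyadic r s = if ∀ k < s, r k = 1 then 2 ^ s else 0 := by
  split_ifs with h
  · rw [signDyadic, Finset.prod_congr rfl fun k hk => by rw [h k (Finset.mem_range.1 hk)]]
    norm_num
  · push Not at h
    obtain ⟨k, hk, h⟩ := h
    refine Finset.prod_eq_zero (Finset.mem_range.2 hk) ?_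
    rw [(hr k).resolve_left h]
    norm_num

/-- In the recursion the factor `(1 + r s) / 2` imposes `r s = 1` on the terms `i < s`. The
remaining `(1 + r s) / 2 * D_{2^s} + D_{2^s}` splits as `(1 - r s) / 2 * D_{2^s} + D_{2^{s+1}}`, the
terms `i = s` and `i = s + 1`. -/
theorem IsSign.signFejerMajorant_eq {r : ℕ → ℝ} (hr : IsSign r) (s : ℕ) :
    signFejerMajorant r s = ∑ i ∈ Finset.range (s + 1), 2 ^ i *
      if ∀ k < s, r k = if k = i then -1 else 1 then 1 else 0 := by
  have hP : ∀ s i, s ≤ i → signDyadic r s =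
      2 ^ s * if ∀ k < s, r k = if k = i then -1 else 1 then 1 else 0 := by
    intro s i hi
    have e : (∀ k < s, r k = if k = i then -1 else 1) ↔ ∀ k < s, r k = 1 :=
      forall₂_congr fun k hk => by rw [if_neg (by omega)]
    rw [signDyadic_eq_ite hr, mul_ite, mul_one, mul_zero]
    simp only [e]
  induction s with
  | zero => simp [signFejerMajorant]
  | succ s ih =>
    rw [signFejerMajorant, Finset.sum_range_succ, Finset.sum_range_succ, ← hP (s + 1) (s + 1) le_rfl,
      signDyadic_succ, ih, Finset.sum_range_succ, ← hP s s le_rfl]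
    have h1 : ∀ i ∈ Finset.range s, (2 : ℝ) ^ i *
        (if ∀ k < s + 1, r k = if k = i then -1 else 1 then 1 else 0) =
        (1 + r s) / 2 * (2 ^ i * if ∀ k < s, r k = if k = i then -1 else 1 then 1 else 0) := by
      intro i hi
      have hne : s ≠ i := by have := Finset.mem_range.1 hi; omega
      simp only [Nat.lt_succ_iff_lt_or_eq, or_imp, forall_and, forall_eq, if_neg hne]
      rcases hr s with h | h
      · simp [h]
      · norm_num [h]
    rw [Finset.sum_congr rfl h1, ← Finset.mul_sum]
    have h2 : (2 : ℝ) ^ s * (if ∀ k < s + 1, r k = if k = s then -1 else 1 then 1 else 0) =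
        (1 - r s) / 2 * signDyadic r s := by
      rw [hP s s le_rfl]
      simp only [Nat.lt_succ_iff_lt_or_eq, or_imp, forall_and, forall_eq, if_true]
      rcases hr s with h | h
      · norm_num [h]
      · norm_num [h]
    rw [h2]
    ring

theorem signFejerMajorant_relSign {x u : ℝ} (hx : x ∈ unitI) (hu : u ∈ unitI) (s : ℕ) :
    signFejerMajorant (relSign x u) s = ∑ i ∈ Finset.range (s + 1), 2 ^ i *
      (dyadicInterval s (dyadicAdd x (1 / 2 ^ (i + 1)))).indicator (fun _ => (1 : ℝ)) u := by
  rw [(isSign_relSign x u).signFejerMajorant_eq]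
  refine Finset.sum_congr rfl fun i _ => ?_
  congr 1
  have hd := exists_digit_eq_one_div hx i
  classical
  rw [Set.indicator_apply]
  refine if_congr ?_ rfl rfl
  rw [mem_dyadicInterval_iff (dyadicAdd_mem_unitI hd) hu]
  refine forall₂_congr fun k _ => ?_
  rw [rademacher_dyadicAdd hd, relSign]
  have h3 : rademacher k (1 / 2 ^ (i + 1)) = if k = i then -1 else 1 := by
    rw [rademacher, digit_one_div_two_pow]
    split_ifs <;> simp
  rw [h3]
  rcases rademacher_eq_one_or k x with h | h <;> rcases rademacher_eq_one_or k u with h' | h' <;>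
    rw [h, h'] <;> split_ifs <;> norm_num

theorem measurableSet_dyadicInterval (n : ℕ) (x : ℝ) : MeasurableSet (dyadicInterval n x) :=
  measurableSet_Ico

theorem volume_dyadicInterval (n : ℕ) (x : ℝ) :
    volume.real (dyadicInterval n x) = 1 / 2 ^ n := by
  rw [dyadicInterval, Real.volume_real_Ico_of_le]
  · ring
  · gcongr; linarith

theorem integral_signFejerMajorant_le (s : ℕ) :
    Integrable (fun u => signFejerMajorant (fun k => rademacher k u) s) μI ∧
      ∫ u, signFejerMajorant (fun k => rademacher k u) s ∂μI ≤ 2 := by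
  have h0 : (0 : ℝ) ∈ unitI := ⟨le_rfl, one_pos⟩
  have e : ∀ᵐ u ∂μI, (∑ i ∈ Finset.range (s + 1), 2 ^ i *
      (dyadicInterval s (dyadicAdd 0 (1 / 2 ^ (i + 1)))).indicator (fun _ => (1 : ℝ)) u) =
      signFejerMajorant (fun k => rademacher k u) s := by
    filter_upwards [ae_restrict_mem measurableSet_Ico] with u hu
    rw [← relSign_zero, signFejerMajorant_relSign h0 hu]
  have hi : ∀ i : ℕ, Integrable (fun u => (2 : ℝ) ^ i *
      (dyadicInterval s (dyadicAdd 0 (1 / 2 ^ (i + 1)))).indicator (fun _ => (1 : ℝ)) u) μI :=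
    fun i => ((integrable_const 1).indicator (measurableSet_dyadicInterval _ _)).const_mul _
  refine ⟨(integrable_finsetSum _ fun i _ => hi i).congr e, ?_⟩
  rw [← integral_congr_ae e, integral_finsetSum _ fun i _ => hi i]
  have h1 : ∀ i ∈ Finset.range (s + 1), ∫ u, (2 : ℝ) ^ i *
      (dyadicInterval s (dyadicAdd 0 (1 / 2 ^ (i + 1)))).indicator (fun _ => (1 : ℝ)) u ∂μI =
      2 ^ i / 2 ^ s := by
    intro i _
    rw [integral_const_mul, integral_indicator (measurableSet_dyadicInterval _ _), integral_const,
      μI, Measure.restrict_restrict (measurableSet_dyadicInterval _ _), Set.inter_eq_left.2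
      (dyadicInterval_subset_unitI (dyadicAdd_mem_unitI (exists_digit_eq_one_div h0 i))),
      measureReal_restrict_apply_univ, volume_dyadicInterval]
    simp [div_eq_mul_inv]
  rw [Finset.sum_congr rfl h1, ← Finset.sum_div, geom_sum_eq (by norm_num),
    div_le_iff₀ (by positivity), pow_succ]
  have : (0 : ℝ) < 2 ^ s := by positivity
  linarith

end Kernels

/-! ### Lower bound for the `L₁` norm of the kernel by `υ`. -/

section LowerBound

variable {t : ℕ → ℝ}

theorem mod_two_pow_mono (n : ℕ) {a b : ℕ} (h : a ≤ b) : n % 2 ^ a ≤ n % 2 ^ b := by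
  rw [← Nat.mod_mod_of_dvd n (pow_dvd_pow 2 h)]
  exact Nat.mod_le _ _

/-- Under these signs `D_{2^A}` is `2 ^ A` up to `A = K + 1` and zero beyond, so the principal part
is an explicit sum whose last two terms carry the digits `K` and `K + 1`. When these differ, the
lower terms cannot cancel the surviving one. -/
theorem IsSign.le_abs_signPrincipal {r : ℕ → ℝ} (hr : IsSign r) (ht0 : ∀ k, 0 ≤ t k)
    (ht : Antitone t) {n L K : ℕ} (hn : n < 2 ^ L) (hK : K < L) (h1 : ∀ k < K + 1, r k = 1)
    (h2 : r (K + 1) = -1) :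
    2 ^ K / 2 * (|(binCoeff n K : ℝ) - binCoeff n (K + 1)| * ∑ l ∈ Finset.range (2 ^ K + 1), t l) ≤
      |signPrincipal r t n L| := by
  set a : ℕ → ℝ := fun A => binCoeff n A * (∑ l ∈ Finset.range (n % 2 ^ (A + 1)), t l) with ha
  have hP : ∀ A, A ≤ K + 1 → signDyadic r A = 2 ^ A := fun A hA => by
    rw [signDyadic_eq_ite hr, if_pos fun k hk => h1 k (by omega)]
  have hP0 : ∀ A, K + 1 < A → signDyadic r A = 0 := fun A hA => by
    rw [signDyadic_eq_ite hr, if_neg fun h => ?_]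
    have := h (K + 1) hA
    rw [h2] at this
    norm_num at this
  have hM : signPrincipal r t n L =
      ∑ A ∈ Finset.range K, a A * 2 ^ A + a K * 2 ^ K - a (K + 1) * 2 ^ (K + 1) := by
    -- The vanishing term `A = L` is added so that the range contains `K + 1` even when `K + 1 = L`.
    have e1 : signPrincipal r t n L =
        ∑ A ∈ Finset.range (L + 1), a A * (signDyadic r (A + 1) - signDyadic r A) := by
      rw [Finset.sum_range_succ]
      have : a L = 0 := by simp [ha, binCoeff_of_lt hn]
      rw [this, zero_mul, add_zero]
      rfl
    rw [e1, ← Finset.sum_subset (Finset.range_mono (show K + 1 + 1 ≤ L + 1 by omega)),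
      Finset.sum_range_succ, Finset.sum_range_succ, hP (K + 1) le_rfl, hP K (by omega),
      hP0 (K + 1 + 1) (by omega)]
    · have : ∑ A ∈ Finset.range K, a A * (signDyadic r (A + 1) - signDyadic r A) =
          ∑ A ∈ Finset.range K, a A * 2 ^ A := by
        refine Finset.sum_congr rfl fun A hA => ?_
        have := Finset.mem_range.1 hA
        rw [hP A (by omega), hP (A + 1) (by omega), pow_succ]
        ring
      rw [this, pow_succ]
      ring
    · intro A _ hA
      rw [Finset.mem_range] at hA
      rw [hP0 A (by omega), hP0 (A + 1) (by omega)]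
      ring
  have hTnn : ∀ k, 0 ≤ ∑ l ∈ Finset.range k, t l := fun k => Finset.sum_nonneg fun l _ => ht0 l
  have hann : ∀ A, 0 ≤ a A := fun A => mul_nonneg (by positivity) (hTnn _)
  have hS0 : 0 ≤ ∑ A ∈ Finset.range K, a A * 2 ^ A :=
    Finset.sum_nonneg fun A _ => mul_nonneg (hann A) (by positivity)
  have hS1 : ∑ A ∈ Finset.range K, a A * 2 ^ A ≤
      (∑ l ∈ Finset.range (n % 2 ^ (K + 2)), t l) * 2 ^ K := by
    have h3 : ∀ A ∈ Finset.range K, a A * 2 ^ A ≤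
        (∑ l ∈ Finset.range (n % 2 ^ (K + 2)), t l) * 2 ^ A := by
      intro A hA
      have h4 := sum_range_mono ht0 (mod_two_pow_mono n
        (show A + 1 ≤ K + 2 by have := Finset.mem_range.1 hA; omega))
      have h5 := hTnn (n % 2 ^ (A + 1))
      refine mul_le_mul_of_nonneg_right ?_ (by positivity)
      rcases binCoeff_eq_zero_or_one n A with h | h
      · simp only [ha, h, Nat.cast_zero, zero_mul]; linarith
      · simp only [ha, h, Nat.cast_one, one_mul]; exact h4
    refine (Finset.sum_le_sum h3).trans ?_
    rw [← Finset.mul_sum, geom_sum_eq (by norm_num)]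
    refine mul_le_mul_of_nonneg_left ?_ (hTnn _)
    norm_num
  have hp : 0 < 2 ^ K := by positivity
  have hp' : (0 : ℝ) < 2 ^ K := by positivity
  have hdouble : ∑ l ∈ Finset.range (2 ^ K + 1), t l ≤ 2 * ∑ l ∈ Finset.range (2 ^ K), t l :=
    (sum_range_mono ht0 (by omega)).trans (sum_range_two_mul_le ht (2 ^ K))
  have e1 := mod_two_pow_succ_eq n K
  have e2 := mod_two_pow_succ_eq n (K + 1)
  rw [hM]
  rcases binCoeff_eq_zero_or_one n K with hb | hb <;>
    rcases binCoeff_eq_zero_or_one n (K + 1) with hc | hc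
  · simp [hb, hc]
  · have h3 : a K = 0 := by simp [ha, hb]
    have h4 : a (K + 1) = ∑ l ∈ Finset.range (n % 2 ^ (K + 2)), t l := by simp [ha, hc]
    rw [hc, mul_one] at e2
    have h5 := sum_range_mono ht0 (show 2 ^ K + 1 ≤ n % 2 ^ (K + 2) by
      rw [show K + 2 = K + 1 + 1 from rfl, e2, pow_succ]; omega)
    have h6 := mul_le_mul_of_nonneg_right h5 hp'.le
    have h7 := mul_nonneg (hTnn (2 ^ K + 1)) hp'.le
    rw [h3, h4, hb, hc, pow_succ (2 : ℝ) K, abs_sub_comm]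
    refine le_trans ?_ (neg_le_abs _)
    norm_num
    linarith
  · have h3 : a K = ∑ l ∈ Finset.range (n % 2 ^ (K + 1)), t l := by simp [ha, hb]
    have h4 : a (K + 1) = 0 := by simp [ha, hc]
    rw [hb, mul_one] at e1
    have h5 := sum_range_mono ht0 (show 2 ^ K ≤ n % 2 ^ (K + 1) by omega)
    have h6 := mul_le_mul_of_nonneg_right (hdouble.trans (mul_le_mul_of_nonneg_left h5 zero_le_two))
      hp'.le
    rw [h3, h4, hb, hc]
    refine le_trans ?_ (le_abs_self _)
    norm_num
    linarith
  · simp [hb, hc]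

theorem rademacher_of_mem_Ico {y : ℝ} {K : ℕ} (hy : y ∈ Set.Ico (1 / 2 ^ (K + 1) : ℝ) (1 / 2 ^ K)) :
    (∀ k < K, rademacher k y = 1) ∧ rademacher K y = -1 := by
  obtain ⟨h1, h2⟩ := hy
  rw [div_le_iff₀ (by positivity), mul_comm] at h1
  rw [lt_div_iff₀ (by positivity), mul_comm] at h2
  have hy0 : 0 ≤ y := by
    have : (0 : ℝ) < 2 ^ (K + 1) := by positivity
    by_contra! h
    nlinarith
  constructor
  · intro k hk
    have h3 : (2 : ℝ) ^ (k + 1) ≤ 2 ^ K := pow_le_pow_right₀ (by norm_num) (by omega)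
    have h4 : ⌊(2 : ℝ) ^ (k + 1) * y⌋₊ = 0 := Nat.floor_eq_zero.2 (by nlinarith)
    simp [rademacher, digit, h4]
  · have h4 : ⌊(2 : ℝ) ^ (K + 1) * y⌋₊ = 1 := by
      rw [Nat.floor_eq_iff (by positivity), pow_succ]
      rw [pow_succ] at h1
      push_cast
      constructor <;> linarith
    simp [rademacher, digit, h4]

theorem rademacher_of_mem_Ico_zero {y : ℝ} {K k : ℕ} (hy : y ∈ Set.Ico (0 : ℝ) (1 / 2 ^ K))
    (hk : k < K) : rademacher k y = 1 := by
  obtain ⟨h1, h2⟩ := hy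
  rw [lt_div_iff₀ (by positivity), mul_comm] at h2
  have h3 : (2 : ℝ) ^ (k + 1) ≤ 2 ^ K := pow_le_pow_right₀ (by norm_num) (by omega)
  have h4 : ⌊(2 : ℝ) ^ (k + 1) * y⌋₊ = 0 := Nat.floor_eq_zero.2 (by nlinarith)
  simp [rademacher, digit, h4]

theorem Ico_subset_unitI (K : ℕ) : Set.Ico (0 : ℝ) (1 / 2 ^ K) ⊆ unitI :=
  Set.Ico_subset_Ico le_rfl
    (by rw [div_le_one (by positivity)]; exact one_le_pow₀ (by norm_num))

theorem μI_Ico (K : ℕ) : μI (Set.Ico (0 : ℝ) (1 / 2 ^ K)) = ENNReal.ofReal (1 / 2 ^ K) := by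
  rw [μI, Measure.restrict_apply measurableSet_Ico, Set.inter_eq_left.2 (Ico_subset_unitI K),
    Real.volume_Ico, sub_zero]

theorem integral_indicator_Ico {a b c : ℝ} (hab : a ≤ b) (ha : 0 ≤ a) (hb : b ≤ 1) :
    ∫ u, (Set.Ico a b).indicator (fun _ => c) u ∂μI = (b - a) * c := by
  have hsub : Set.Ico a b ⊆ unitI := Set.Ico_subset_Ico ha hb
  rw [integral_indicator measurableSet_Ico, integral_const, μI,
    Measure.restrict_restrict measurableSet_Ico, Set.inter_eq_left.2 hsub,
    measureReal_restrict_apply_univ, Real.volume_real_Ico_of_le hab, smul_eq_mul]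

theorem one_div_two_pow_le_one (K : ℕ) : (1 : ℝ) / 2 ^ K ≤ 1 := by
  rw [div_le_one (by positivity)]
  exact one_le_pow₀ (by norm_num)

theorem one_div_two_pow_succ_le (K : ℕ) : (1 : ℝ) / 2 ^ (K + 1) ≤ 1 / 2 ^ K :=
  one_div_le_one_div_of_le (by positivity) (pow_le_pow_right₀ (by norm_num) (Nat.le_succ K))

theorem integrable_signKernel (t : ℕ → ℝ) (n : ℕ) :
    Integrable (fun u => signKernel (fun k => rademacher k u) t n) μI := by
  have := integrable_signKernel_relSign 0 t n
  simp only [relSign_zero] at this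
  exact this

/-- The disjoint intervals `[2^{-K-2}, 2^{-K-1})` each see one digit jump. Height `2^K / 2` times
length `2^{-K-2}` gives `1/8`, hence the factor `8`; the error has norm at most `2 * 4`, which gives
`64`. -/
theorem sum_abs_sub_mul_le (ht0 : ∀ k, 0 ≤ t k) (ht : Antitone t) {n L : ℕ} (hn : n < 2 ^ L)
    (h1 : ∑ l ∈ Finset.range (n + 1), t l = 1) :
    ∑ K ∈ Finset.range L, |(binCoeff n K : ℝ) - binCoeff n (K + 1)| *
        ∑ l ∈ Finset.range (2 ^ K + 1), t l ≤
      8 * ∫ u, |signKernel (fun k => rademacher k u) t n| ∂μI + 64 := by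
  set b : ℕ → ℝ := fun K => |(binCoeff n K : ℝ) - binCoeff n (K + 1)| *
    ∑ l ∈ Finset.range (2 ^ K + 1), t l with hb
  set E : ℕ → Set ℝ := fun K => Set.Ico (1 / 2 ^ (K + 1 + 1) : ℝ) (1 / 2 ^ (K + 1)) with hE
  have hpt : ∀ y, ∑ K ∈ Finset.range L, (E K).indicator (fun _ => 2 ^ K / 2 * b K) y ≤
      |signPrincipal (fun k => rademacher k y) t n L| := by
    intro y
    by_cases h : ∃ K ∈ Finset.range L, y ∈ E K
    · obtain ⟨K, hKL, hK⟩ := h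
      have hr := rademacher_of_mem_Ico hK
      rw [Finset.sum_eq_single_of_mem K hKL, Set.indicator_of_mem hK]
      · exact (isSign_rademacher y).le_abs_signPrincipal ht0 ht hn (Finset.mem_range.1 hKL) hr.1 hr.2
      · intro K' _ hne
        refine Set.indicator_of_notMem (fun hK' => ?_) _
        have hr' := rademacher_of_mem_Ico hK'
        rcases lt_or_gt_of_ne hne with hlt | hlt
        · have := hr.1 (K' + 1) (by omega)
          rw [hr'.2] at this
          norm_num at this
        · have := hr'.1 (K + 1) (by omega)
          rw [hr.2] at this
          norm_num at this
    · push Not at h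
      rw [Finset.sum_eq_zero fun K hK => Set.indicator_of_notMem (h K hK) _]
      exact abs_nonneg _
  have hle : ∀ y, ∑ K ∈ Finset.range L, (E K).indicator (fun _ => 2 ^ K / 2 * b K) y ≤
      |signKernel (fun k => rademacher k y) t n| + ∑ s ∈ Finset.range L,
        errorCoeff t n L s * signFejerMajorant (fun k => rademacher k y) s := by
    intro y
    have h2 := (isSign_rademacher y).abs_signKernel_sub_le ht0 ht hn
    have h3 := abs_sub_abs_le_abs_sub
      (signWalsh (fun k => rademacher k y) n * signPrincipal (fun k => rademacher k y) t n L)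
      (signKernel (fun k => rademacher k y) t n)
    rw [abs_sub_comm, abs_mul, (isSign_rademacher y).abs_signWalsh, one_mul] at h3
    linarith [hpt y]
  have hI1 : ∀ K, Integrable ((E K).indicator (fun _ => 2 ^ K / 2 * b K)) μI := fun K =>
    (integrable_const _).indicator measurableSet_Ico
  have hI2 : ∀ s, Integrable (fun y => errorCoeff t n L s *
      signFejerMajorant (fun k => rademacher k y) s) μI := fun s =>
    (integral_signFejerMajorant_le s).1.const_mul _
  have hint := integral_mono (integrable_finsetSum _ fun K _ => hI1 K)
    ((integrable_signKernel t n).abs.add (integrable_finsetSum _ fun s _ => hI2 s)) hle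
  simp only [Pi.add_apply] at hint
  rw [integral_add (integrable_signKernel t n).abs (integrable_finsetSum _ fun s _ => hI2 s),
    integral_finsetSum _ fun K _ => hI1 K, integral_finsetSum _ fun s _ => hI2 s] at hint
  have e1 : ∀ K ∈ Finset.range L, ∫ y, (E K).indicator (fun _ => 2 ^ K / 2 * b K) y ∂μI =
      b K / 8 := by
    intro K _
    rw [hE, integral_indicator_Ico (one_div_two_pow_succ_le _) (by positivity)
      (one_div_two_pow_le_one _), pow_succ (2 : ℝ) (K + 1), pow_succ (2 : ℝ) K]
    field_simp
    norm_num
    ring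
  have e2 : ∀ s ∈ Finset.range L, ∫ y, errorCoeff t n L s *
      signFejerMajorant (fun k => rademacher k y) s ∂μI ≤ errorCoeff t n L s * 2 := by
    intro s _
    rw [integral_const_mul]
    exact mul_le_mul_of_nonneg_left (integral_signFejerMajorant_le s).2 (errorCoeff_nonneg ht0 _ _ _)
  have h4 := Finset.sum_le_sum e2
  rw [← Finset.sum_mul] at h4
  rw [Finset.sum_congr rfl e1, ← Finset.sum_div] at hint
  have h5 := sum_errorCoeff_le ht0 ht hn
  have h6 := (sum_range_mono ht0 (Nat.le_succ n)).trans h1.le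
  linarith

end LowerBound

/-! ### From operator norms to bounds for `υ`. -/

section OperatorNorms

theorem IsTransformationMatrix.antitone {t : ℕ → ℕ → ℝ} (ht : IsTransformationMatrix t) (n : ℕ) :
    Antitone fun k => t k n := antitone_nat_of_succ_le fun k => ht.mono k n

theorem upsilon_le {t : ℕ → ℕ → ℝ} (ht : IsTransformationMatrix t) (n : ℕ) :
    upsilon t n ≤
      8 * ∫ u, |signKernel (fun k => rademacher k u) (fun k => t k n) n| ∂μI + 64 :=
  sum_abs_sub_mul_le (fun k => ht.nonneg k n) (ht.antitone n)
    (Nat.lt_pow_succ_log_self (by norm_num) n) (ht.sum_eq_one n)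

theorem walsh_of_mem_Ico {j L : ℕ} (hj : j < 2 ^ L) {x : ℝ} (hx : x ∈ Set.Ico (0 : ℝ) (1 / 2 ^ L)) :
    walsh j x = 1 := by
  rw [walsh_eq, signWalsh_eq_prod _ hj]
  refine Finset.prod_eq_one fun k hk => ?_
  rw [rademacher_of_mem_Ico_zero hx (Finset.mem_range.1 hk), one_pow]

/-- The mean is tested on the sign of the kernel. All Walsh functions involved are one on `[0,
2^{-L})`, so the mean equals the `L₁` norm there. -/
theorem integral_abs_signKernel_le_opNormInfty (t : ℕ → ℕ → ℝ) (n : ℕ) :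
    ENNReal.ofReal (∫ u, |signKernel (fun k => rademacher k u) (fun k => t k n) n| ∂μI) ≤
      opNormInfty (weightedMean t n) := by
  set V : ℝ → ℝ := fun u => signKernel (fun k => rademacher k u) (fun k => t k n) n with hV
  have hVm : Measurable V := by
    have := measurable_signKernel_relSign 0 (fun k => t k n) n
    simp only [relSign_zero] at this
    exact this
  set f : ℝ → ℝ := fun u => if 0 ≤ V u then 1 else -1 with hf
  have hfm : Measurable f :=
    Measurable.ite (measurableSet_le measurable_const hVm) measurable_const measurable_const
  have hfb : ∀ u, ‖f u‖ ≤ 1 := fun u => by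
    simp only [hf]; split_ifs <;> simp
  have hfi : Integrable f μI := Integrable.of_bound hfm.aestronglyMeasurable 1
    (Eventually.of_forall hfb)
  have hfL : MemLp f ∞ μI := memLp_top_of_bound hfm.aestronglyMeasurable 1 (Eventually.of_forall hfb)
  have hf1 : eLpNorm f ∞ μI ≤ 1 := by
    have := eLpNorm_le_of_ae_bound (p := ∞) (μ := μI) (Eventually.of_forall hfb)
    simpa using this
  have hle : eLpNorm (weightedMean t n f) ∞ μI ≤ opNormInfty (weightedMean t n) :=
    le_iSup₂_of_le f hfL (le_iSup_of_le hf1 le_rfl)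
  refine le_trans ?_ hle
  have hn : n < 2 ^ (Nat.log 2 n + 1) := Nat.lt_pow_succ_log_self (by norm_num) n
  set L := Nat.log 2 n + 1
  have hW : ∀ j, Integrable (fun u => f u * walsh j u) μI := fun j => by
    have h2 : Measurable (walsh j) := by
      have := measurable_signWalsh_relSign 0 j
      simp only [relSign_zero] at this
      exact this
    refine hfi.mul_bdd (c := 1) h2.aestronglyMeasurable (Eventually.of_forall fun u => ?_)
    rw [Real.norm_eq_abs, walsh_eq, (isSign_rademacher u).abs_signWalsh]
  have hval : ∀ x ∈ Set.Ico (0 : ℝ) (1 / 2 ^ L), weightedMean t n f x = ∫ u, |V u| ∂μI := by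
    intro x hx
    have h1 : ∀ u, |V u| = ∑ k ∈ Finset.range (n + 1), t (n - k) n *
        ∑ j ∈ Finset.range k, f u * walsh j u := by
      intro u
      have h2 : |V u| = f u * V u := by
        simp only [hf]
        split_ifs with h
        · rw [one_mul, abs_of_nonneg h]
        · rw [neg_one_mul, abs_of_neg (not_le.1 h)]
      rw [h2]
      simp only [hV, signKernel, signDirichlet, ← walsh_eq, Finset.mul_sum]
      refine Finset.sum_congr rfl fun k _ => Finset.sum_congr rfl fun j _ => ?_
      ring
    simp only [h1]
    rw [integral_finsetSum _ fun k _ => (integrable_finsetSum _ fun j _ => hW j).const_mul _]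
    refine Finset.sum_congr rfl fun k hk => ?_
    rw [integral_const_mul, integral_finsetSum _ fun j _ => hW j, partialSum]
    congr 1
    refine Finset.sum_congr rfl fun j hj => ?_
    have hj' := Finset.mem_range.1 hj
    have hk' := Finset.mem_range.1 hk
    rw [walsh_of_mem_Ico (by omega) hx, mul_one, walshCoeff]
  have hae : ∀ᵐ x ∂μI, ‖weightedMean t n f x‖ₑ ≤ eLpNorm (weightedMean t n f) ∞ μI := by
    rw [eLpNorm_exponent_top]
    exact ae_le_eLpNormEssSup
  have hpos : μI (Set.Ico (0 : ℝ) (1 / 2 ^ L)) ≠ 0 := by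
    rw [μI_Ico]
    simp
  -- An almost everywhere bound can be evaluated at some point of a set of positive measure.
  obtain ⟨x, hx, hx2⟩ := (frequently_ae_mem_iff.2 hpos).and_eventually hae |>.exists
  rw [hval x hx] at hx2
  refine le_trans (le_of_eq ?_) hx2
  rw [Real.enorm_eq_ofReal_abs, abs_of_nonneg (integral_nonneg fun u => abs_nonneg _)]

/-- The function `r_A 2 ^ A 1_{[0, 2 ^ (-A))}`. -/
def dyadicAtom (A : ℕ) (u : ℝ) : ℝ :=
  (Set.Ico (0 : ℝ) (1 / 2 ^ (A + 1))).indicator (fun _ => (2 : ℝ) ^ A) u -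
    (Set.Ico (1 / 2 ^ (A + 1) : ℝ) (1 / 2 ^ A)).indicator (fun _ => (2 : ℝ) ^ A) u

theorem dyadicAtom_eq (A : ℕ) (u : ℝ) :
    dyadicAtom A u =
      (Set.Ico (0 : ℝ) (1 / 2 ^ A)).indicator (fun _ => (2 : ℝ) ^ A) u * rademacher A u := by
  have h1 := one_div_two_pow_succ_le A
  have h0 : (0 : ℝ) < 1 / 2 ^ (A + 1) := by positivity
  unfold dyadicAtom
  by_cases ha : u ∈ Set.Ico (0 : ℝ) (1 / 2 ^ (A + 1))
  · have ha' : u ∈ Set.Ico (0 : ℝ) (1 / 2 ^ A) := ⟨ha.1, ha.2.trans_le h1⟩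
    rw [Set.indicator_of_mem ha, Set.indicator_of_mem ha',
      Set.indicator_of_notMem (fun h => ha.2.not_ge h.1),
      rademacher_of_mem_Ico_zero ha (Nat.lt_succ_self A)]
    ring
  · rw [Set.indicator_of_notMem ha]
    by_cases hb : u ∈ Set.Ico (1 / 2 ^ (A + 1) : ℝ) (1 / 2 ^ A)
    · have hb' : u ∈ Set.Ico (0 : ℝ) (1 / 2 ^ A) := ⟨h0.le.trans hb.1, hb.2⟩
      rw [Set.indicator_of_mem hb, Set.indicator_of_mem hb',
        (rademacher_of_mem_Ico hb).2]
      ring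
    · rw [Set.indicator_of_notMem hb, Set.indicator_of_notMem, zero_mul, sub_zero]
      intro h
      rcases lt_or_ge u (1 / 2 ^ (A + 1)) with h' | h'
      · exact ha ⟨h.1, h'⟩
      · exact hb ⟨h', h.2⟩

theorem dyadicAtom_of_notMem {A : ℕ} {u : ℝ} (h : u ∉ Set.Ico (0 : ℝ) (1 / 2 ^ A)) :
    dyadicAtom A u = 0 := by
  rw [dyadicAtom_eq, Set.indicator_of_notMem h, zero_mul]

theorem abs_dyadicAtom_le (A : ℕ) (u : ℝ) : |dyadicAtom A u| ≤ 2 ^ A := by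
  rw [dyadicAtom_eq, abs_mul, (isSign_rademacher u).abs_eq A, mul_one, ← Real.norm_eq_abs]
  refine (norm_indicator_le_norm_self _ _).trans ?_
  simp

theorem integrable_dyadicAtom (A : ℕ) : Integrable (dyadicAtom A) μI :=
  ((integrable_const _).indicator measurableSet_Ico).sub
    ((integrable_const _).indicator measurableSet_Ico)

theorem integral_dyadicAtom (A : ℕ) : ∫ u, dyadicAtom A u ∂μI = 0 := by
  unfold dyadicAtom
  rw [integral_sub ((integrable_const _).indicator measurableSet_Ico)
      ((integrable_const _).indicator measurableSet_Ico),
    integral_indicator_Ico (by positivity) le_rfl (one_div_two_pow_le_one _),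
    integral_indicator_Ico (one_div_two_pow_succ_le A) (by positivity) (one_div_two_pow_le_one _),
    pow_succ]
  field_simp
  norm_num

/-- A dyadic interval with a point outside the support of the atom either contains that support,
where the atom has mean zero, or misses it. -/
theorem setIntegral_dyadicAtom {A n : ℕ} {x : ℝ} (hx : x ∈ unitI)
    (hxA : x ∉ Set.Ico (0 : ℝ) (1 / 2 ^ A)) : ∫ u in dyadicInterval n x, dyadicAtom A u = 0 := by
  have hxA' : 1 / 2 ^ A ≤ x := by
    by_contra! h
    exact hxA ⟨hx.1, h⟩
  have hpA : (0 : ℝ) < 2 ^ A := by positivity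
  have hpn : (0 : ℝ) < 2 ^ n := by positivity
  have hp0 : 0 ≤ ⌊(2 : ℝ) ^ n * x⌋ := Int.floor_nonneg.2 (mul_nonneg hpn.le hx.1)
  rcases hp0.eq_or_lt with hp | hp
  · have hsub : Set.Ico (0 : ℝ) (1 / 2 ^ A) ⊆ dyadicInterval n x := by
      rw [dyadicInterval, ← hp]
      have h1 := Int.lt_floor_add_one ((2 : ℝ) ^ n * x)
      rw [← hp, Int.cast_zero, zero_add] at h1
      rw [Int.cast_zero, zero_div, zero_add]
      refine Set.Ico_subset_Ico le_rfl (hxA'.trans ?_)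
      rw [le_div_iff₀ hpn, mul_comm]
      exact h1.le
    have e : ∫ u in dyadicInterval n x, dyadicAtom A u = ∫ u in unitI, dyadicAtom A u := by
      rw [setIntegral_eq_integral_of_forall_compl_eq_zero
          fun u hu => dyadicAtom_of_notMem fun h => hu (hsub h),
        setIntegral_eq_integral_of_forall_compl_eq_zero
          fun u hu => dyadicAtom_of_notMem fun h => hu (Ico_subset_unitI A h)]
    rw [e]
    exact integral_dyadicAtom A
  · refine setIntegral_eq_zero_of_forall_eq_zero fun u hu => dyadicAtom_of_notMem fun h => ?_
    refine h.2.not_ge (le_trans ?_ hu.1)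
    rw [div_le_div_iff₀ hpA hpn, one_mul]
    rcases le_or_gt n A with hnA | hnA
    · have h1 : (2 : ℝ) ^ n ≤ 2 ^ A := pow_le_pow_right₀ (by norm_num) hnA
      have h2 : (1 : ℝ) ≤ ⌊(2 : ℝ) ^ n * x⌋ := by exact_mod_cast hp
      nlinarith
    · obtain ⟨c, rfl⟩ := Nat.exists_eq_add_of_lt hnA
      have h2 : (2 : ℤ) ^ (c + 1) ≤ ⌊(2 : ℝ) ^ (A + c + 1) * x⌋ := by
        rw [Int.le_floor]
        push_cast
        rw [div_le_iff₀ hpA] at hxA'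
        have : (2 : ℝ) ^ (A + c + 1) * x = 2 ^ (c + 1) * (x * 2 ^ A) := by ring
        rw [this]
        have : (0 : ℝ) < 2 ^ (c + 1) := by positivity
        nlinarith
      have h3 : (2 : ℝ) ^ (c + 1) ≤ ⌊(2 : ℝ) ^ (A + c + 1) * x⌋ := by exact_mod_cast h2
      calc (2 : ℝ) ^ (A + c + 1) = 2 ^ (c + 1) * 2 ^ A := by ring
        _ ≤ _ := mul_le_mul_of_nonneg_right h3 hpA.le

theorem hardyNorm_dyadicAtom_le (A : ℕ) : hardyNorm (dyadicAtom A) ≤ 1 := by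
  have h : ∀ x ∈ unitI,
      ⨆ n : ℕ, ENNReal.ofReal (2 ^ n * |∫ u in dyadicInterval n x, dyadicAtom A u|) ≤
      (Set.Ico (0 : ℝ) (1 / 2 ^ A)).indicator (fun _ => ENNReal.ofReal (2 ^ A)) x := by
    intro x hx
    refine iSup_le fun n => ?_
    by_cases hxA : x ∈ Set.Ico (0 : ℝ) (1 / 2 ^ A)
    · rw [Set.indicator_of_mem hxA]
      refine ENNReal.ofReal_le_ofReal ?_
      have h1 : ‖∫ u in dyadicInterval n x, dyadicAtom A u‖ ≤
          2 ^ A * volume.real (dyadicInterval n x) :=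
        norm_setIntegral_le_of_norm_le_const (by rw [dyadicInterval]; exact measure_Ico_lt_top)
          fun u _ => abs_dyadicAtom_le A u
      rw [volume_dyadicInterval, Real.norm_eq_abs, mul_one_div, le_div_iff₀ (by positivity)] at h1
      linarith
    · rw [setIntegral_dyadicAtom hx hxA]
      simp
  have hae : ∀ᵐ x ∂μI, x ∈ unitI := ae_restrict_mem measurableSet_Ico
  rw [hardyNorm]
  refine (lintegral_mono_ae (hae.mono h)).trans ?_
  rw [lintegral_indicator measurableSet_Ico, setLIntegral_const, μI_Ico,
    ← ENNReal.ofReal_mul (by positivity), mul_one_div_cancel (by positivity), ENNReal.ofReal_one]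

theorem walshCoeff_dyadicAtom_of_lt {A j : ℕ} (hj : j < 2 ^ A) :
    walshCoeff (dyadicAtom A) j = 0 := by
  rw [walshCoeff, ← integral_dyadicAtom A]
  congr 1
  funext u
  by_cases h : u ∈ Set.Ico (0 : ℝ) (1 / 2 ^ A)
  · rw [walsh_of_mem_Ico hj h, mul_one]
  · rw [dyadicAtom_of_notMem h, zero_mul]

theorem walshCoeff_dyadicAtom_two_pow_add {A j : ℕ} (hj : j < 2 ^ A) :
    walshCoeff (dyadicAtom A) (2 ^ A + j) = 1 := by
  have e : ∀ u, dyadicAtom A u * walsh (2 ^ A + j) u =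
      (Set.Ico (0 : ℝ) (1 / 2 ^ A)).indicator (fun _ => (2 : ℝ) ^ A) u := by
    intro u
    by_cases h : u ∈ Set.Ico (0 : ℝ) (1 / 2 ^ A)
    · rw [dyadicAtom_eq, walsh_eq, signWalsh_two_pow_add _ hj, ← walsh_eq, walsh_of_mem_Ico hj h,
        mul_one, mul_assoc, (isSign_rademacher u).mul_self A, mul_one]
    · rw [dyadicAtom_of_notMem h, zero_mul, Set.indicator_of_notMem h]
  simp only [walshCoeff, e]
  rw [integral_indicator_Ico (by positivity) le_rfl (one_div_two_pow_le_one _), sub_zero,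
    one_div_mul_cancel (by positivity)]

/-- The partial sums of the atom vanish up to order `2 ^ A`, and then `S_{2^A+k}` gives `r_A D_k`.
The weights stay those of row `2 ^ A + m`. -/
theorem weightedMean_dyadicAtom (t : ℕ → ℕ → ℝ) {A m : ℕ} (hm : m < 2 ^ A) (x : ℝ) :
    weightedMean t (2 ^ A + m) (dyadicAtom A) x = rademacher A x *
      signKernel (fun k => rademacher k x) (fun k => t k (2 ^ A + m)) m := by
  have h0 : ∀ k, k ≤ 2 ^ A → partialSum k (dyadicAtom A) x = 0 := fun k hk =>
    Finset.sum_eq_zero fun j hj => by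
      rw [walshCoeff_dyadicAtom_of_lt ((Finset.mem_range.1 hj).trans_le hk), zero_mul]
  rw [weightedMean, add_assoc, Finset.sum_range_add, Finset.sum_eq_zero fun k hk => by
    rw [h0 k (Finset.mem_range.1 hk).le, mul_zero], zero_add, signKernel, Finset.mul_sum]
  refine Finset.sum_congr rfl fun k hk => ?_
  have hk' := Finset.mem_range.1 hk
  have h1 : partialSum (2 ^ A + k) (dyadicAtom A) x =
      rademacher A x * signDirichlet (fun k => rademacher k x) k := by
    rw [partialSum, Finset.sum_range_add]
    have h2 := h0 (2 ^ A) le_rfl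
    rw [partialSum] at h2
    rw [h2, zero_add, signDirichlet, Finset.mul_sum]
    refine Finset.sum_congr rfl fun j hj => ?_
    have hj' := Finset.mem_range.1 hj
    rw [walshCoeff_dyadicAtom_two_pow_add (by omega), one_mul, walsh_eq,
      signWalsh_two_pow_add _ (by omega)]
  rw [h1, Nat.add_sub_add_left]
  ring

theorem integral_abs_signKernel_le_opNormHardy (t : ℕ → ℕ → ℝ) {A m : ℕ} (hm : m < 2 ^ A) :
    ENNReal.ofReal
        (∫ u, |signKernel (fun k => rademacher k u) (fun k => t k (2 ^ A + m)) m| ∂μI) ≤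
      opNormHardy (weightedMean t (2 ^ A + m)) := by
  have h1 := hardyNorm_dyadicAtom_le A
  have h2 : MemHardy (dyadicAtom A) := ⟨integrable_dyadicAtom A, h1.trans_lt ENNReal.one_lt_top⟩
  have hle : eLpNorm (weightedMean t (2 ^ A + m) (dyadicAtom A)) 1 μI ≤
      opNormHardy (weightedMean t (2 ^ A + m)) :=
    le_iSup₂_of_le (dyadicAtom A) h2 (le_iSup_of_le h1 le_rfl)
  refine le_trans (le_of_eq ?_) hle
  rw [ofReal_integral_eq_lintegral_ofReal (integrable_signKernel _ _).abs
    (Eventually.of_forall fun u => abs_nonneg _), eLpNorm_one_eq_lintegral_enorm]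
  refine lintegral_congr fun u => ?_
  rw [weightedMean_dyadicAtom t hm, Real.enorm_eq_ofReal_abs, abs_mul,
    (isSign_rademacher u).abs_eq A, one_mul]

/-- In the recursion for index `2 ^ A + m` the term with `D_{2^A}` has norm at most `2`, and the
reflected sum at most `2 * 2 * 2`: from its coefficients, the norm of `G_s` and dyadic condensation.
-/
theorem integral_abs_signKernel_two_pow_add_le {t : ℕ → ℝ} (ht0 : ∀ k, 0 ≤ t k) (ht : Antitone t)
    {A m : ℕ} (hm : m < 2 ^ A) (h1 : ∑ l ∈ Finset.range (2 ^ A + m + 1), t l = 1) :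
    ∫ u, |signKernel (fun k => rademacher k u) t (2 ^ A + m)| ∂μI ≤
      10 + ∫ u, |signKernel (fun k => rademacher k u) t m| ∂μI := by
  have hT : ∑ l ∈ Finset.range (2 ^ A + m), t l ≤ 1 :=
    (sum_range_mono ht0 (Nat.le_succ _)).trans h1.le
  have hTnn : 0 ≤ ∑ l ∈ Finset.range (2 ^ A + m), t l := Finset.sum_nonneg fun l _ => ht0 l
  have hpt : ∀ u, |signKernel (fun k => rademacher k u) t (2 ^ A + m)| ≤
      signFejerMajorant (fun k => rademacher k u) A + ∑ s ∈ Finset.range (A + 1),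
        2 * (2 ^ s * t (m + (2 ^ s - 1))) * signFejerMajorant (fun k => rademacher k u) s +
      |signKernel (fun k => rademacher k u) t m| := by
    intro u
    have hr := isSign_rademacher u
    rw [hr.signKernel_two_pow_add t hm]
    have h2 := hr.abs_sum_mul_signDirichlet (t := fun j => t (m + j)) (fun k => ht0 _)
        (fun a b hab => ht (by omega)) A
    have h3 := hr.signDyadic_le_signFejerMajorant A
    have h4 := hr.signDyadic_nonneg A
    refine (abs_add_le _ _).trans (add_le_add ((abs_sub _ _).trans (add_le_add ?_ ?_)) ?_)
    · rw [abs_mul, abs_of_nonneg hTnn, abs_of_nonneg h4]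
      nlinarith
    · rw [abs_mul, hr.abs_signWalsh, one_mul]
      exact h2
    · rw [abs_mul, hr.abs_eq A, one_mul]
  have hG := fun s => (integral_signFejerMajorant_le s).1
  have hS : Integrable (fun u => ∑ s ∈ Finset.range (A + 1),
      2 * (2 ^ s * t (m + (2 ^ s - 1))) * signFejerMajorant (fun k => rademacher k u) s) μI :=
    integrable_finsetSum _ fun s _ => (hG s).const_mul _
  have hGS := (hG A).add hS
  simp only [Pi.add_def] at hGS
  have hint := integral_mono (integrable_signKernel t (2 ^ A + m)).abs
    (hGS.add (integrable_signKernel t m).abs) hpt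
  simp only [Pi.add_apply] at hint
  rw [integral_add hGS (integrable_signKernel t m).abs, integral_add (hG A) hS,
    integral_finsetSum _ fun s _ => (hG s).const_mul _] at hint
  have h5 : ∑ s ∈ Finset.range (A + 1), ∫ u, 2 * (2 ^ s * t (m + (2 ^ s - 1))) *
      signFejerMajorant (fun k => rademacher k u) s ∂μI ≤
      ∑ s ∈ Finset.range (A + 1), 4 * (2 ^ s * t (m + (2 ^ s - 1))) := by
    refine Finset.sum_le_sum fun s _ => ?_
    have h6 := ht0 (m + (2 ^ s - 1))
    rw [integral_const_mul]
    have := mul_le_mul_of_nonneg_left (integral_signFejerMajorant_le s).2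
      (show 0 ≤ 2 * (2 ^ s * t (m + (2 ^ s - 1))) by positivity)
    linarith
  rw [← Finset.mul_sum] at h5
  have h6 := sum_two_pow_mul_le (t := fun j => t (m + j)) (fun k => ht0 _)
      (fun a b hab => ht (by omega)) A
  have h7 : ∑ l ∈ Finset.range (2 ^ A), t (m + l) ≤ ∑ l ∈ Finset.range (2 ^ A + m), t l := by
    rw [add_comm, Finset.sum_range_add t]
    have : 0 ≤ ∑ l ∈ Finset.range m, t l := Finset.sum_nonneg fun l _ => ht0 l
    linarith
  have h8 := (integral_signFejerMajorant_le A).2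
  linarith

theorem upsilon_le_of_opNormHardy {t : ℕ → ℕ → ℝ} (ht : IsTransformationMatrix t) (n : ℕ)
    (hfin : opNormHardy (weightedMean t n) ≠ ∞) :
    upsilon t n ≤ 8 * (opNormHardy (weightedMean t n)).toReal + 144 := by
  have h := upsilon_le ht n
  rcases Nat.eq_zero_or_pos n with rfl | hn
  · have e : ∀ u, signKernel (fun k => rademacher k u) (fun k => t k 0) 0 = 0 := fun u => by
      simp [signKernel, signDirichlet_zero]
    simp only [e, abs_zero, integral_zero] at h
    have : 0 ≤ (opNormHardy (weightedMean t 0)).toReal := ENNReal.toReal_nonneg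
    linarith
  · obtain ⟨m, hm, hnm⟩ := exists_two_pow_add (Nat.pow_log_le_self 2 hn.ne')
      (Nat.lt_pow_succ_log_self (by norm_num) n)
    set A := Nat.log 2 n
    rw [hnm] at h hfin ⊢
    have h1 := integral_abs_signKernel_two_pow_add_le (fun k => ht.nonneg k (2 ^ A + m))
      (ht.antitone (2 ^ A + m)) hm (ht.sum_eq_one (2 ^ A + m))
    -- Passing from index `m` to `n` costs `10`, so the constant is `64 + 8 * 10`.
    have h2 := (ENNReal.ofReal_le_iff_le_toReal hfin).1 (integral_abs_signKernel_le_opNormHardy t hm)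
    linarith

theorem upsilon_le_of_opNormInfty {t : ℕ → ℕ → ℝ} (ht : IsTransformationMatrix t) (n : ℕ)
    (hfin : opNormInfty (weightedMean t n) ≠ ∞) :
    upsilon t n ≤ 8 * (opNormInfty (weightedMean t n)).toReal + 64 := by
  have h := upsilon_le ht n
  have h2 := (ENNReal.ofReal_le_iff_le_toReal hfin).1 (integral_abs_signKernel_le_opNormInfty t n)
  linarith

theorem exists_upsilon_le {t : ℕ → ℕ → ℝ} (ht : IsTransformationMatrix t) {n : ℕ → ℕ}
    (hbdd : (⨆ a : ℕ, opNormHardy (weightedMean t (n a))) < ∞ ∨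
      (⨆ a : ℕ, opNormInfty (weightedMean t (n a))) < ∞ ∨
      BddAbove (Set.range fun a : ℕ => upsilon t (n a))) :
    ∃ C, ∀ a, upsilon t (n a) ≤ C := by
  rcases hbdd with h | h | h
  · refine ⟨8 * (⨆ a : ℕ, opNormHardy (weightedMean t (n a))).toReal + 144, fun a => ?_⟩
    have h1 := le_iSup (fun a : ℕ => opNormHardy (weightedMean t (n a))) a
    have h2 := upsilon_le_of_opNormHardy ht (n a) (h1.trans_lt h).ne
    have h3 := ENNReal.toReal_mono h.ne h1
    linarith
  · refine ⟨8 * (⨆ a : ℕ, opNormInfty (weightedMean t (n a))).toReal + 64, fun a => ?_⟩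
    have h1 := le_iSup (fun a : ℕ => opNormInfty (weightedMean t (n a))) a
    have h2 := upsilon_le_of_opNormInfty ht (n a) (h1.trans_lt h).ne
    have h3 := ENNReal.toReal_mono h.ne h1
    linarith
  · obtain ⟨C, hC⟩ := h
    exact ⟨C, fun a => hC ⟨a, rfl⟩⟩

end OperatorNorms

/-! ### The deviation of the means bounded by the averages `W`. -/

section Averages

variable {f : ℝ × ℝ → ℝ} {x : ℝ × ℝ}

theorem μI_prod_eq : μI.prod μI = volume.restrict (unitI ×ˢ unitI) := by
  rw [μI, Measure.prod_restrict]; rfl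

theorem measurableSet_unitI : MeasurableSet unitI := measurableSet_Ico

theorem integrable_abs_sub (hf : Integrable f (μI.prod μI)) (x : ℝ × ℝ) :
    Integrable (fun u => |f u - f x|) (μI.prod μI) :=
  (hf.sub (integrable_const _)).abs

/-- The dyadic interval `I_n(x ∔ 2 ^ (-i - 1))`. -/
def shiftedInterval (n i : ℕ) (x : ℝ) : Set ℝ := dyadicInterval n (dyadicAdd x (1 / 2 ^ (i + 1)))

theorem measurableSet_shiftedInterval (n i : ℕ) (x : ℝ) : MeasurableSet (shiftedInterval n i x) :=
  measurableSet_dyadicInterval _ _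

theorem shiftedInterval_subset {x : ℝ} (hx : x ∈ unitI) (n i : ℕ) :
    shiftedInterval n i x ⊆ unitI :=
  dyadicInterval_subset_unitI (dyadicAdd_mem_unitI (exists_digit_eq_one_div hx i))

theorem integral_indicator_prod (g : ℝ × ℝ → ℝ) {S T : Set ℝ} (hS : MeasurableSet S)
    (hT : MeasurableSet T) (hSI : S ⊆ unitI) (hTI : T ⊆ unitI) :
    ∫ u, (S ×ˢ T).indicator g u ∂(μI.prod μI) = ∫ u in S ×ˢ T, g u := by
  rw [integral_indicator (hS.prod hT), μI_prod_eq, Measure.restrict_restrict (hS.prod hT),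
    Set.inter_eq_left.2 (Set.prod_mono hSI hTI)]

/-- The kernel `G_A ⊗ G_B` integrates `|f - f x|` to `W_{A,B} f(x)`. -/
theorem integral_mul_signFejerMajorant (hf : Integrable f (μI.prod μI))
    (hx : x ∈ unitI ×ˢ unitI) (A B : ℕ) :
    Integrable (fun u : ℝ × ℝ => |f u - f x| * (signFejerMajorant (relSign x.1 u.1) A *
      signFejerMajorant (relSign x.2 u.2) B)) (μI.prod μI) ∧
    ∫ u : ℝ × ℝ, |f u - f x| * (signFejerMajorant (relSign x.1 u.1) A *
      signFejerMajorant (relSign x.2 u.2) B) ∂(μI.prod μI) = lebesgueW f x A B := by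
  have hi : ∀ i j, Integrable (fun u => (2 : ℝ) ^ (i + j) *
      (shiftedInterval A i x.1 ×ˢ shiftedInterval B j x.2).indicator
        (fun u => |f u - f x|) u) (μI.prod μI) := fun i j =>
    ((integrable_abs_sub hf x).indicator ((measurableSet_shiftedInterval _ _ _).prod
      (measurableSet_shiftedInterval _ _ _))).const_mul _
  have e : ∀ᵐ u : ℝ × ℝ ∂(μI.prod μI), ∑ i ∈ Finset.range (A + 1), ∑ j ∈ Finset.range (B + 1),
      (2 : ℝ) ^ (i + j) * (shiftedInterval A i x.1 ×ˢ shiftedInterval B j x.2).indicator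
        (fun u => |f u - f x|) u =
      |f u - f x| * (signFejerMajorant (relSign x.1 u.1) A *
        signFejerMajorant (relSign x.2 u.2) B) := by
    rw [μI_prod_eq]
    filter_upwards [ae_restrict_mem (measurableSet_unitI.prod measurableSet_unitI)] with u hu
    rw [signFejerMajorant_relSign hx.1 hu.1, signFejerMajorant_relSign hx.2 hu.2,
      Finset.sum_mul_sum, Finset.mul_sum]
    refine Finset.sum_congr rfl fun i _ => ?_
    rw [Finset.mul_sum]
    refine Finset.sum_congr rfl fun j _ => ?_
    classical
    simp only [Set.indicator_apply, Set.mem_prod, shiftedInterval]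
    by_cases h1 : u.1 ∈ dyadicInterval A (dyadicAdd x.1 (1 / 2 ^ (i + 1))) <;>
      by_cases h2 : u.2 ∈ dyadicInterval B (dyadicAdd x.2 (1 / 2 ^ (j + 1))) <;>
      simp only [h1, h2, and_true, and_false, if_true, if_false] <;> ring
  refine ⟨(integrable_finsetSum _ fun i _ => integrable_finsetSum _ fun j _ => hi i j).congr e, ?_⟩
  rw [← integral_congr_ae e,
    integral_finsetSum _ fun i _ => integrable_finsetSum _ fun j _ => hi i j]
  refine Finset.sum_congr rfl fun i _ => ?_
  rw [integral_finsetSum _ fun j _ => hi i j]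
  refine Finset.sum_congr rfl fun j _ => ?_
  rw [integral_const_mul, integral_indicator_prod _ (measurableSet_shiftedInterval _ _ _)
    (measurableSet_shiftedInterval _ _ _) (shiftedInterval_subset hx.1 _ _)
    (shiftedInterval_subset hx.2 _ _)]
  rfl

theorem lebesgueW_nonneg (f : ℝ × ℝ → ℝ) (x : ℝ × ℝ) (A B : ℕ) : 0 ≤ lebesgueW f x A B :=
  Finset.sum_nonneg fun _ _ => Finset.sum_nonneg fun _ _ =>
    mul_nonneg (by positivity) (integral_nonneg fun _ => abs_nonneg _)

theorem setIntegral_abs_sub_mono (hf : Integrable f (μI.prod μI)) (x : ℝ × ℝ)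
    {S T : Set (ℝ × ℝ)} (hT : T ⊆ unitI ×ˢ unitI) (hST : S ⊆ T) :
    ∫ u in S, |f u - f x| ≤ ∫ u in T, |f u - f x| := by
  have h := integrable_abs_sub hf x
  rw [μI_prod_eq] at h
  exact setIntegral_mono_set (IntegrableOn.mono_set h hT)
    (Eventually.of_forall fun _ => abs_nonneg _) (Eventually.of_forall hST)

/-- Enlarging the first side to the whole unit interval leaves, for fixed `A`, a bound uniform in
`B` at a Walsh–Lebesgue point. -/
theorem lebesgueW_le_mul_lebesgueH₁ (hf : Integrable f (μI.prod μI)) (hx : x ∈ unitI ×ˢ unitI)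
    (A B : ℕ) : lebesgueW f x A B ≤ (∑ i ∈ Finset.range (A + 1), 2 ^ i) * lebesgueH₁ f x B := by
  rw [lebesgueW, lebesgueH₁, Finset.sum_mul_sum]
  refine Finset.sum_le_sum fun i _ => Finset.sum_le_sum fun j _ => ?_
  rw [pow_add, mul_assoc]
  have hj : dyadicInterval B (dyadicAdd x.2 (1 / 2 ^ (j + 1))) ⊆ unitI :=
    shiftedInterval_subset hx.2 B j
  gcongr ?_ * (?_ * ?_)
  exact setIntegral_abs_sub_mono hf x (Set.prod_mono_right hj)
    (Set.prod_mono_left (shiftedInterval_subset hx.1 A i))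

theorem lebesgueW_le_mul_lebesgueH₀ (hf : Integrable f (μI.prod μI)) (hx : x ∈ unitI ×ˢ unitI)
    (A B : ℕ) : lebesgueW f x A B ≤ (∑ j ∈ Finset.range (B + 1), 2 ^ j) * lebesgueH₀ f x A := by
  rw [lebesgueW, lebesgueH₀, Finset.sum_mul_sum, Finset.sum_comm]
  refine Finset.sum_le_sum fun j _ => Finset.sum_le_sum fun i _ => ?_
  rw [add_comm, pow_add, mul_assoc]
  have hi : dyadicInterval A (dyadicAdd x.1 (1 / 2 ^ (i + 1))) ⊆ unitI :=
    shiftedInterval_subset hx.1 A i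
  gcongr ?_ * (?_ * ?_)
  exact setIntegral_abs_sub_mono hf x (Set.prod_mono_left hi)
    (Set.prod_mono_right (shiftedInterval_subset hx.2 B j))

theorem abs_tensorMean_sub_le (hf : Integrable f (μI.prod μI)) (hx : x ∈ unitI ×ˢ unitI)
    {t₀ t₁ : ℕ → ℕ → ℝ} (ht₀ : IsTransformationMatrix t₀) (ht₁ : IsTransformationMatrix t₁)
    (n₀ n₁ : ℕ) :
    |tensorMean t₀ t₁ n₀ n₁ f x - f x| ≤
      ∑ A ∈ Finset.range (Nat.log 2 n₀ + 2), ∑ B ∈ Finset.range (Nat.log 2 n₁ + 2),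
        kernelCoeff (fun k => t₀ k n₀) n₀ A * kernelCoeff (fun k => t₁ k n₁) n₁ B *
          lebesgueW f x A B +
      |f x * ((∑ l ∈ Finset.range n₀, t₀ l n₀) * (∑ l ∈ Finset.range n₁, t₁ l n₁) - 1)| := by
  set V₀ : ℝ → ℝ := fun u => signKernel (relSign x.1 u) (fun k => t₀ k n₀) n₀ with hV₀
  set V₁ : ℝ → ℝ := fun u => signKernel (relSign x.2 u) (fun k => t₁ k n₁) n₁ with hV₁
  have hV₀i : Integrable V₀ μI := integrable_signKernel_relSign _ _ _
  have hV₁i : Integrable V₁ μI := integrable_signKernel_relSign _ _ _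
  have hVi : Integrable (fun u : ℝ × ℝ => V₀ u.1 * V₁ u.2) (μI.prod μI) := hV₀i.mul_prod hV₁i
  have hVint : ∫ u : ℝ × ℝ, V₀ u.1 * V₁ u.2 ∂(μI.prod μI) =
      (∑ l ∈ Finset.range n₀, t₀ l n₀) * ∑ l ∈ Finset.range n₁, t₁ l n₁ := by
    rw [integral_prod_mul, integral_signKernel_relSign, integral_signKernel_relSign]
  have hfV : Integrable (fun u : ℝ × ℝ => f u * (V₀ u.1 * V₁ u.2)) (μI.prod μI) := by
    refine hf.mul_bdd (c := (∑ k ∈ Finset.range (n₀ + 1), |t₀ (n₀ - k) n₀| * k) *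
      ∑ k ∈ Finset.range (n₁ + 1), |t₁ (n₁ - k) n₁| * k) hVi.aestronglyMeasurable
      (Eventually.of_forall fun u => ?_)
    rw [Real.norm_eq_abs, abs_mul]
    have h1 := (isSign_relSign x.1 u.1).abs_signKernel_le_const (fun k => t₀ k n₀) n₀
    have h2 := (isSign_relSign x.2 u.2).abs_signKernel_le_const (fun k => t₁ k n₁) n₁
    exact mul_le_mul h1 h2 (abs_nonneg _) ((abs_nonneg _).trans h1)
  have hmean : tensorMean t₀ t₁ n₀ n₁ f x =
      ∫ u : ℝ × ℝ, f u * (V₀ u.1 * V₁ u.2) ∂(μI.prod μI) := by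
    -- The Rademacher functions are multiplicative on dyadic sums only off a null set of `u` in each
    -- coordinate.
    refine integral_congr_ae ?_
    filter_upwards [Measure.quasiMeasurePreserving_fst.ae (ae_rademacher_dyadicAdd x.1),
      Measure.quasiMeasurePreserving_snd.ae (ae_rademacher_dyadicAdd x.2)] with u h1 h2
    rw [meanKernel_eq, meanKernel_eq, h1, h2]
  have hsplit : tensorMean t₀ t₁ n₀ n₁ f x - f x =
      ∫ u : ℝ × ℝ, (f u - f x) * (V₀ u.1 * V₁ u.2) ∂(μI.prod μI) +
      f x * ((∑ l ∈ Finset.range n₀, t₀ l n₀) * (∑ l ∈ Finset.range n₁, t₁ l n₁) - 1) := by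
    simp only [sub_mul]
    rw [integral_sub hfV (hVi.const_mul _), integral_const_mul, hVint, hmean]
    ring
  rw [hsplit]
  refine (abs_add_le _ _).trans (add_le_add ?_ le_rfl)
  have hW := fun A B => integral_mul_signFejerMajorant hf hx A B
  set c₀ := kernelCoeff (fun k => t₀ k n₀) n₀
  set c₁ := kernelCoeff (fun k => t₁ k n₁) n₁
  have hi : ∀ A B, Integrable (fun u : ℝ × ℝ => c₀ A * c₁ B * (|f u - f x| *
      (signFejerMajorant (relSign x.1 u.1) A * signFejerMajorant (relSign x.2 u.2) B)))
      (μI.prod μI) := fun A B => (hW A B).1.const_mul _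
  have hpt : ∀ u : ℝ × ℝ, ‖(f u - f x) * (V₀ u.1 * V₁ u.2)‖ ≤
      ∑ A ∈ Finset.range (Nat.log 2 n₀ + 2), ∑ B ∈ Finset.range (Nat.log 2 n₁ + 2),
        c₀ A * c₁ B * (|f u - f x| *
          (signFejerMajorant (relSign x.1 u.1) A * signFejerMajorant (relSign x.2 u.2) B)) := by
    intro u
    have h1 := (isSign_relSign x.1 u.1).abs_signKernel_le (fun k => ht₀.nonneg k n₀)
      (ht₀.antitone n₀) n₀
    have h2 := (isSign_relSign x.2 u.2).abs_signKernel_le (fun k => ht₁.nonneg k n₁)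
      (ht₁.antitone n₁) n₁
    rw [Real.norm_eq_abs, abs_mul, abs_mul]
    refine (mul_le_mul_of_nonneg_left (mul_le_mul h1 h2 (abs_nonneg _)
      ((abs_nonneg _).trans h1)) (abs_nonneg _)).trans (le_of_eq ?_)
    rw [Finset.sum_mul_sum, Finset.mul_sum]
    refine Finset.sum_congr rfl fun A _ => ?_
    rw [Finset.mul_sum]
    refine Finset.sum_congr rfl fun B _ => ?_
    ring
  have h3 := norm_integral_le_of_norm_le (integrable_finsetSum _ fun A _ =>
    integrable_finsetSum _ fun B _ => hi A B) (Eventually.of_forall hpt)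
  rw [Real.norm_eq_abs, integral_finsetSum _ fun A _ => integrable_finsetSum _ fun B _ => hi A B]
    at h3
  refine h3.trans (le_of_eq (Finset.sum_congr rfl fun A _ => ?_))
  rw [integral_finsetSum _ fun B _ => hi A B]
  refine Finset.sum_congr rfl fun B _ => ?_
  rw [integral_const_mul, (hW A B).2]

end Averages

/-! ### Toeplitz summation and limits of the coefficients. -/

section Summability

theorem sum_mul_ite_le {c u : ℕ → ℝ} (hc : ∀ A, 0 ≤ c A) (hu : ∀ A, 0 ≤ u A) (N K : ℕ) :
    ∑ A ∈ Finset.range N, c A * (if A < K then u A else 0) ≤ ∑ A ∈ Finset.range K, c A * u A := by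
  simp only [mul_ite, mul_zero]
  rw [← Finset.sum_filter]
  refine Finset.sum_le_sum_of_subset_of_nonneg (fun A hA => ?_) fun A _ _ =>
    mul_nonneg (hc A) (hu A)
  exact Finset.mem_range.2 (Finset.mem_filter.1 hA).2

/-- A Toeplitz type lemma for double sums. -/
theorem tendsto_double_sum {ι : Type*} {l : Filter ι} {W : ℕ → ℕ → ℝ}
    (hW0 : ∀ A B, 0 ≤ W A B)
    (hW : Tendsto (fun m : ℕ × ℕ => W m.1 m.2)
      (comap (fun m : ℕ × ℕ => min m.1 m.2) atTop) (𝓝 0))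
    (h₁ : ∀ A, ∃ C, ∀ B, W A B ≤ C) (h₂ : ∀ B, ∃ C, ∀ A, W A B ≤ C)
    {c₀ c₁ : ι → ℕ → ℝ} {N₀ N₁ : ι → ℕ} {C₀ C₁ : ℝ}
    (hc₀ : ∀ a A, 0 ≤ c₀ a A) (hc₁ : ∀ a A, 0 ≤ c₁ a A)
    (hC₀ : ∀ a, ∑ A ∈ Finset.range (N₀ a), c₀ a A ≤ C₀)
    (hC₁ : ∀ a, ∑ A ∈ Finset.range (N₁ a), c₁ a A ≤ C₁)
    (hl₀ : ∀ A, Tendsto (fun a => c₀ a A) l (𝓝 0)) (hl₁ : ∀ A, Tendsto (fun a => c₁ a A) l (𝓝 0)) :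
    Tendsto (fun a => ∑ A ∈ Finset.range (N₀ a), ∑ B ∈ Finset.range (N₁ a),
      c₀ a A * c₁ a B * W A B) l (𝓝 0) := by
  choose u hu using h₁
  choose v hv using h₂
  have hu0 : ∀ A, 0 ≤ u A := fun A => (hW0 A 0).trans (hu A 0)
  have hv0 : ∀ B, 0 ≤ v B := fun B => (hW0 0 B).trans (hv B 0)
  rw [tendsto_order]
  refine ⟨fun b hb => Eventually.of_forall fun a => hb.trans_le (Finset.sum_nonneg fun A _ =>
    Finset.sum_nonneg fun B _ => mul_nonneg (mul_nonneg (hc₀ a A) (hc₁ a B)) (hW0 A B)),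
    fun ε hε => ?_⟩
  have hD : 0 < |C₀| * |C₁| + 1 := by positivity
  obtain ⟨K, hK⟩ : ∃ K, ∀ A B, K ≤ A → K ≤ B → W A B ≤ ε / 2 / (|C₀| * |C₁| + 1) := by
    have h := (tendsto_order.1 hW).2 (ε / 2 / (|C₀| * |C₁| + 1)) (by positivity)
    obtain ⟨s, hs, hsub⟩ := mem_comap.1 h
    obtain ⟨K, hK⟩ := mem_atTop_sets.1 hs
    exact ⟨K, fun A B hA hB => le_of_lt (@hsub (A, B) (hK _ (le_min hA hB)))⟩
  set δ := ε / 2 / (|C₀| * |C₁| + 1)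
  have hδ : 0 ≤ δ := by positivity
  have hbound : ∀ a, ∑ A ∈ Finset.range (N₀ a), ∑ B ∈ Finset.range (N₁ a),
      c₀ a A * c₁ a B * W A B ≤ ε / 2 +
        ((∑ A ∈ Finset.range K, c₀ a A * u A) * |C₁| +
          (∑ B ∈ Finset.range K, c₁ a B * v B) * |C₀|) := by
    intro a
    have e : ∑ A ∈ Finset.range (N₀ a), ∑ B ∈ Finset.range (N₁ a), c₀ a A * c₁ a B * W A B ≤
        ∑ A ∈ Finset.range (N₀ a), ∑ B ∈ Finset.range (N₁ a), (c₀ a A * c₁ a B * δ +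
          (c₀ a A * (if A < K then u A else 0)) * c₁ a B +
          c₀ a A * (c₁ a B * (if B < K then v B else 0))) := by
      refine Finset.sum_le_sum fun A _ => Finset.sum_le_sum fun B _ => ?_
      -- Either both indices are at least `K` and `W` is below `δ`, or a small index selects the
      -- bound uniform in the other one.
      have h1 : W A B ≤ δ + (if A < K then u A else 0) + (if B < K then v B else 0) := by
        have := hu A B
        have := hv B A
        have := hu0 A
        have := hv0 B
        split_ifs with hA hB hB
        · linarith
        · linarith
        · linarith
        · linarith [hK A B (not_lt.1 hA) (not_lt.1 hB)]
      have h2 := mul_le_mul_of_nonneg_left h1 (mul_nonneg (hc₀ a A) (hc₁ a B))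
      linarith
    have e2 : ∑ A ∈ Finset.range (N₀ a), ∑ B ∈ Finset.range (N₁ a), (c₀ a A * c₁ a B * δ +
          (c₀ a A * (if A < K then u A else 0)) * c₁ a B +
          c₀ a A * (c₁ a B * (if B < K then v B else 0))) =
        (∑ A ∈ Finset.range (N₀ a), c₀ a A) * (∑ B ∈ Finset.range (N₁ a), c₁ a B) * δ +
        (∑ A ∈ Finset.range (N₀ a), c₀ a A * (if A < K then u A else 0)) *
          (∑ B ∈ Finset.range (N₁ a), c₁ a B) +
        (∑ A ∈ Finset.range (N₀ a), c₀ a A) *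
          (∑ B ∈ Finset.range (N₁ a), c₁ a B * (if B < K then v B else 0)) := by
      simp only [Finset.sum_add_distrib, Finset.sum_mul_sum]
      simp only [Finset.sum_mul]
    have s0 : 0 ≤ ∑ A ∈ Finset.range (N₀ a), c₀ a A := Finset.sum_nonneg fun A _ => hc₀ a A
    have s1 : 0 ≤ ∑ A ∈ Finset.range (N₁ a), c₁ a A := Finset.sum_nonneg fun A _ => hc₁ a A
    have s0' := (hC₀ a).trans (le_abs_self C₀)
    have s1' := (hC₁ a).trans (le_abs_self C₁)
    have p0 := sum_mul_ite_le (hc₀ a) hu0 (N₀ a) K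
    have p1 := sum_mul_ite_le (hc₁ a) hv0 (N₁ a) K
    have p0' : 0 ≤ ∑ A ∈ Finset.range K, c₀ a A * u A :=
      Finset.sum_nonneg fun A _ => mul_nonneg (hc₀ a A) (hu0 A)
    have p1' : 0 ≤ ∑ A ∈ Finset.range (N₁ a), c₁ a A * (if A < K then v A else 0) :=
      Finset.sum_nonneg fun A _ => mul_nonneg (hc₁ a A) (by split_ifs <;> simp [hv0])
    have q1 := mul_le_mul_of_nonneg_right (mul_le_mul s0' s1' s1 (abs_nonneg _)) hδ
    have q2 := mul_le_mul p0 s1' s1 p0'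
    have q3 := mul_le_mul s0' p1 p1' (abs_nonneg _)
    have q4 : |C₀| * |C₁| * δ ≤ ε / 2 := by
      have : (|C₀| * |C₁| + 1) * δ = ε / 2 := mul_div_cancel₀ _ hD.ne'
      nlinarith
    linarith
  have hlim : Tendsto (fun a => (∑ A ∈ Finset.range K, c₀ a A * u A) * |C₁| +
      (∑ B ∈ Finset.range K, c₁ a B * v B) * |C₀|) l
      (𝓝 ((∑ A ∈ Finset.range K, 0 * u A) * |C₁| + (∑ B ∈ Finset.range K, 0 * v B) * |C₀|)) :=
    ((tendsto_finsetSum _ fun A _ => (hl₀ A).mul_const _).mul_const _).add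
      ((tendsto_finsetSum _ fun A _ => (hl₁ A).mul_const _).mul_const _)
  simp only [zero_mul, Finset.sum_const_zero, add_zero] at hlim
  filter_upwards [(tendsto_order.1 hlim).2 (ε / 2) (by linarith)] with a ha
  linarith [hbound a]

/-- Since `D_0 = 0`, the kernel has mass `1 - t_{n,n}`, and `t_{n,n} ≤ t_{0,n}`. -/
theorem tendsto_sum_range {ι : Type*} {l : Filter ι} {t : ℕ → ℕ → ℝ}
    (ht : IsTransformationMatrix t) {n : ι → ℕ} (hlim : Tendsto (fun a => t 0 (n a)) l (𝓝 0)) :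
    Tendsto (fun a => ∑ k ∈ Finset.range (n a), t k (n a)) l (𝓝 1) := by
  have h1 : ∀ a, ∑ k ∈ Finset.range (n a), t k (n a) = 1 - t (n a) (n a) := fun a => by
    rw [← ht.sum_eq_one (n a), Finset.sum_range_succ, add_sub_cancel_right]
  have h2 : Tendsto (fun a => t (n a) (n a)) l (𝓝 0) :=
    squeeze_zero (fun a => ht.nonneg _ _) (fun a => ht.antitone (n a) (Nat.zero_le _)) hlim
  simp only [h1]
  simpa using h2.const_sub 1

theorem IsTransformationMatrix.kernelCoeff_nonneg {t : ℕ → ℕ → ℝ} (ht : IsTransformationMatrix t)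
    (n s : ℕ) : 0 ≤ kernelCoeff (fun k => t k n) n s :=
  WalshPaley.kernelCoeff_nonneg (t := fun k => t k n) (fun k => ht.nonneg k n) (ht.antitone n) n s

theorem IsTransformationMatrix.sum_kernelCoeff_le {t : ℕ → ℕ → ℝ} (ht : IsTransformationMatrix t)
    (n : ℕ) : ∑ s ∈ Finset.range (Nat.log 2 n + 2), kernelCoeff (fun k => t k n) n s ≤
      5 + 4 * upsilon t n :=
  WalshPaley.sum_kernelCoeff_le (t := fun k => t k n) (fun k => ht.nonneg k n) (ht.antitone n)
    (ht.sum_eq_one n)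

theorem IsTransformationMatrix.tendsto_kernelCoeff {ι : Type*} {l : Filter ι} {t : ℕ → ℕ → ℝ}
    (ht : IsTransformationMatrix t) {n : ι → ℕ} (hlim : Tendsto (fun a => t 0 (n a)) l (𝓝 0))
    (s : ℕ) : Tendsto (fun a => kernelCoeff (fun k => t k (n a)) (n a) s) l (𝓝 0) :=
  WalshPaley.tendsto_kernelCoeff (t := fun a k => t k (n a)) (n := n)
    (fun a k => ht.nonneg k (n a)) (fun a => ht.antitone (n a)) (fun a => ht.sum_eq_one (n a)) hlim s

theorem tendsto_comap_min {n₀ n₁ : ℕ → ℕ} (h₀ : StrictMono n₀) (h₁ : StrictMono n₁) :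
    Tendsto Prod.fst (comap (fun p : ℕ × ℕ => min (n₀ p.1) (n₁ p.2)) atTop) atTop ∧
    Tendsto Prod.snd (comap (fun p : ℕ × ℕ => min (n₀ p.1) (n₁ p.2)) atTop) atTop := by
  have h : Tendsto (fun p : ℕ × ℕ => min (n₀ p.1) (n₁ p.2))
      (comap (fun p : ℕ × ℕ => min (n₀ p.1) (n₁ p.2)) atTop) atTop := tendsto_comap
  rw [tendsto_atTop, tendsto_atTop]
  constructor <;> intro K
  · filter_upwards [h.eventually_ge_atTop (n₀ K)] with p hp
    exact h₀.le_iff_le.1 (hp.trans (min_le_left _ _))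
  · filter_upwards [h.eventually_ge_atTop (n₁ K)] with p hp
    exact h₁.le_iff_le.1 (hp.trans (min_le_right _ _))

end Summability

end WalshPaley

end

/-! ### The convergence theorem. -/

theorem theorem2
    (t : Fin 2 → ℕ → ℕ → ℝ) (ht : ∀ i, WalshPaley.IsTransformationMatrix (t i))
    (n : Fin 2 → ℕ → ℕ) (hn : ∀ i, StrictMono (n i))
    (hbdd : ∀ i,
      (⨆ a : ℕ, WalshPaley.opNormHardy (WalshPaley.weightedMean (t i) (n i a))) < ∞ ∨
      (⨆ a : ℕ, WalshPaley.opNormInfty (WalshPaley.weightedMean (t i) (n i a))) < ∞ ∨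
      BddAbove (Set.range fun a : ℕ => WalshPaley.upsilon (t i) (n i a)))
    (ht0 : ∀ i, Tendsto (fun a : ℕ => t i 0 (n i a)) atTop (𝓝 0))
    (f : ℝ × ℝ → ℝ) (hf : WalshPaley.MemLLogL f)
    (x : ℝ × ℝ) (hx : WalshPaley.IsWalshLebesguePoint f x) :
    Tendsto
      (fun p : ℕ × ℕ => WalshPaley.tensorMean (t 0) (t 1) (n 0 p.1) (n 1 p.2) f x)
      (comap (fun p : ℕ × ℕ => min (n 0 p.1) (n 1 p.2)) atTop)
      (𝓝 (f x)) := by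
  obtain ⟨hfst, hsnd⟩ := WalshPaley.tendsto_comap_min (hn 0) (hn 1)
  set l := comap (fun p : ℕ × ℕ => min (n 0 p.1) (n 1 p.2)) atTop
  choose C hC using fun i => WalshPaley.exists_upsilon_le (ht i) (hbdd i)
  have hcoeff : ∀ i a, ∑ s ∈ Finset.range (Nat.log 2 (n i a) + 2),
      WalshPaley.kernelCoeff (fun k => t i k (n i a)) (n i a) s ≤ 5 + 4 * C i := fun i a => by
    linarith [(ht i).sum_kernelCoeff_le (n i a), hC i a]
  have hdouble := WalshPaley.tendsto_double_sum (l := l)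
    (c₀ := fun p => WalshPaley.kernelCoeff (fun k => t 0 k (n 0 p.1)) (n 0 p.1))
    (c₁ := fun p => WalshPaley.kernelCoeff (fun k => t 1 k (n 1 p.2)) (n 1 p.2))
    (N₀ := fun p => Nat.log 2 (n 0 p.1) + 2) (N₁ := fun p => Nat.log 2 (n 1 p.2) + 2)
    (WalshPaley.lebesgueW_nonneg f x)
    hx.tendsto_W
    (fun A => by
      obtain ⟨D, hD⟩ := hx.bdd_H₁
      exact ⟨_, fun B => (WalshPaley.lebesgueW_le_mul_lebesgueH₁ hf.1 hx.mem A B).trans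
        (mul_le_mul_of_nonneg_left (hD ⟨B, rfl⟩) (by positivity))⟩)
    (fun B => by
      obtain ⟨D, hD⟩ := hx.bdd_H₀
      exact ⟨_, fun A => (WalshPaley.lebesgueW_le_mul_lebesgueH₀ hf.1 hx.mem A B).trans
        (mul_le_mul_of_nonneg_left (hD ⟨A, rfl⟩) (by positivity))⟩)
    (fun p => (ht 0).kernelCoeff_nonneg (n 0 p.1)) (fun p => (ht 1).kernelCoeff_nonneg (n 1 p.2))
    (fun p => hcoeff 0 p.1) (fun p => hcoeff 1 p.2)
    ((ht 0).tendsto_kernelCoeff ((ht0 0).comp hfst)) ((ht 1).tendsto_kernelCoeff ((ht0 1).comp hsnd))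
  -- The product of the two kernel masses tends to one, which removes the term with the factor `f
  -- x`.
  have hmass := (((WalshPaley.tendsto_sum_range (ht 0) ((ht0 0).comp hfst)).mul
    (WalshPaley.tendsto_sum_range (ht 1) ((ht0 1).comp hsnd))).sub_const 1).const_mul (f x) |>.abs
  have htot := hdouble.add hmass
  simp only [mul_one, sub_self, mul_zero, abs_zero, add_zero] at htot
  rw [tendsto_iff_dist_tendsto_zero]
  refine squeeze_zero (fun _ => dist_nonneg) (fun p => ?_) htot
  rw [Real.dist_eq]
  exact WalshPaley.abs_tensorMean_sub_le hf.1 hx.mem (ht 0) (ht 1) (n 0 p.1) (n 1 p.2)
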